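/- **Theorem (Positivity).** Let $\varepsilon>0$ and let $C:\mathbb R^2\to\mathbb R^2$ (the velocity field $\mathbf{C_y}$ of individuals with a fixed home location $y$) be bounded, uniformly continuous and of class $C^1$, with bounded and uniformly continuous partial derivatives $\partial_{x_1}C,\partial_{x_2}C$. Let $\Pi(t)z$ be the flow of $C$, i.e. $\partial_t\Pi(t)z=C(\Pi(t)z)$ for $t\in\mathbb R$, $\Pi(0)z=z$. On $L^1(\mathbb R^2)$ let $A$ be the infinitesimal generator of the heat semigroup $$T_{\varepsilon^2\Delta}(t)u(x)=\int_{\mathbb R^2}\frac{1}{4\pi\varepsilon^2t}e^{-|x-z|^2/(4\varepsilon^2t)}u(z)\,dz\quad(t>0),\qquad T_{\varepsilon^2\Delta}(0)u=u,$$ and let $B_y$ be the infinitesimal generator of the semigroup $$T_{B_y}(t)u(x)=\exp\Big(-\int_0^t(\nabla\cdot C)(\Pi(-\sigma)x)\,d\sigma\Big)\,u(\Pi(-t)x)\quad(t\ge0).$$ Then $D(A)\subset D(B_y)$, and $A+B_y$ with domain $D(A)$ is the infinitesimal generator of a strongly continuous semigroup $\{T_{A+B_y}(t)\}_{t\ge0}$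 of bounded linear operators on $L^1(\mathbb R^2)$. For each $v_0\in L^1(\mathbb R^2)$ the map $t\mapsto T_{A+B_y}(t)v_0$ is the unique mild solution of $$v'(t)=(A+B_y)v(t)\ (t\ge 0),\qquad v(0)=v_0,$$ that is, the unique continuous $v:[0,\infty)\to L^1(\mathbb R^2)$ such that, for all $t\ge0$, $\int_0^tv(s)\,ds\in D(A)$ and $v(t)=v_0+(A+B_y)\int_0^tv(s)\,ds$. Moreover this semigroup is positive: if $v_0\in L^1(\mathbb R^2)$ and $v_0\ge0$ a.e., then $$T_{A+B_y}(t)v_0\ge0\ \text{ a.e.,}\qquad\forall t\ge0.$$ -/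

import Mathlib

open MeasureTheory Set Filter Topology

noncomputable section

namespace ReturnHome

/-! ### Strongly continuous semigroups, generators, mild solutions -/

section Semigroups

variable {X : Type*} [NormedAddCommGroup X] [NormedSpace ℝ X]

/-- A strongly continuous semigroup `(T t)` of bounded linear operators; only the values at
times `t ≥ 0` matter. -/
structure IsC0Semigroup (T : ℝ → X →L[ℝ] X) : Prop where
  zero : T 0 = ContinuousLinearMap.id ℝ X
  add : ∀ s t : ℝ, 0 ≤ s → 0 ≤ t → T (s + t) = (T s).comp (T t)
  continuousOn : ∀ u : X, ContinuousOn (fun t : ℝ => T t u) (Ici 0)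

/-- `f` is the right derivative at time `0` of the orbit of `u`. -/
def IsGeneratorValue (T : ℝ → X →L[ℝ] X) (u f : X) : Prop :=
  Tendsto (fun t : ℝ => t⁻¹ • (T t u - u)) (𝓝[>] 0) (𝓝 f)

/-- The domain of the generator: all `u` for which `(T t u - u) / t` converges in norm as
`t ↘ 0`. -/
def generatorDomain (T : ℝ → X →L[ℝ] X) : Submodule ℝ X where
  carrier := {u | ∃ f, IsGeneratorValue T u f}
  zero_mem' := ⟨0, by simp [IsGeneratorValue]⟩
  add_mem' := by
    rintro u v ⟨f, hf⟩ ⟨g, hg⟩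
    refine ⟨f + g, (Tendsto.add hf hg).congr fun t => ?_⟩
    rw [map_add, ← smul_add]
    congr 1
    abel
  smul_mem' := by
    rintro c u ⟨f, hf⟩
    refine ⟨c • f, (Tendsto.const_smul hf c).congr fun t => ?_⟩
    rw [map_smul, ← smul_sub, smul_comm]

/-- The infinitesimal generator `u ↦ lim_{t ↘ 0} (T t u - u) / t`, as an unbounded operator. -/
def generator (T : ℝ → X →L[ℝ] X) : X →ₗ.[ℝ] X where
  domain := generatorDomain T
  toFun :=
    { toFun := fun u => Classical.choose u.2
      map_add' := by
        intro u v
        have hu : IsGeneratorValue T u _ := Classical.choose_spec u.2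
        have hv : IsGeneratorValue T v _ := Classical.choose_spec v.2
        have h : IsGeneratorValue T (u + v : X) _ := Classical.choose_spec (u + v).2
        refine tendsto_nhds_unique h ((Tendsto.add hu hv).congr fun t => ?_)
        rw [map_add, ← smul_add]
        congr 1
        abel
      map_smul' := by
        intro c u
        have hu : IsGeneratorValue T u _ := Classical.choose_spec u.2
        have h : IsGeneratorValue T (c • u : X) _ := Classical.choose_spec (c • u).2
        refine tendsto_nhds_unique h ((Tendsto.const_smul hu c).congr fun t => ?_)
        rw [map_smul, ← smul_sub, smul_comm] }

theorem generator_spec (T : ℝ → X →L[ℝ] X) (u : (generator T).domain) :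
    IsGeneratorValue T u (generator T u) :=
  Classical.choose_spec u.2

/-- `v`, continuous on `[0, ∞)`, is a mild solution of `v' = G v`, `v 0 = v₀`: for all `t ≥ 0`,
`∫₀ᵗ v(s) ds ∈ D(G)` and `v t = v₀ + G (∫₀ᵗ v(s) ds)`. -/
def IsMildSolution (G : X →ₗ.[ℝ] X) (v₀ : X) (v : ℝ → X) : Prop :=
  ContinuousOn v (Ici 0) ∧
    ∀ t : ℝ, 0 ≤ t → ∃ h : (∫ s in (0 : ℝ)..t, v s) ∈ G.domain,
      v t = v₀ + G ⟨∫ s in (0 : ℝ)..t, v s, h⟩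

end Semigroups

/-! ### The diffusion and convection semigroups on `L¹(ℝ²)` -/

/-- The Euclidean plane. -/
abbrev Plane : Type := EuclideanSpace ℝ (Fin 2)

/-- `L¹(ℝ²)`, with Lebesgue measure; its order is the a.e. pointwise order. -/
abbrev L1 : Type := Lp ℝ 1 (volume : Measure Plane)

/-- The partial derivative `∂_{x_i} C` of a vector field. -/
def partialDeriv (C : Plane → Plane) (i : Fin 2) (x : Plane) : Plane :=
  fderiv ℝ C x (EuclideanSpace.single i (1 : ℝ))

/-- The divergence `∂_{x₁} C₁ + ∂_{x₂} C₂`. -/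
def divergence (C : Plane → Plane) (x : Plane) : ℝ :=
  ∑ i : Fin 2, partialDeriv C i x i

/-- The standing assumption on the velocity field: `C` is bounded, uniformly continuous and `C¹`,
and its first partial derivatives are bounded and uniformly continuous. -/
structure IsAdmissibleVelocity (C : Plane → Plane) : Prop where
  bounded : ∃ M : ℝ, ∀ x, ‖C x‖ ≤ M
  uniformContinuous : UniformContinuous C
  contDiff : ContDiff ℝ 1 C
  partialDeriv_bounded : ∀ i, ∃ M : ℝ, ∀ x, ‖partialDeriv C i x‖ ≤ M
  partialDeriv_uniformContinuous : ∀ i, UniformContinuous (partialDeriv C i)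

/-- The bounded operator on `L¹(ℝ²)` that is given a.e. by the formula `F u` for every `u`. It is
unique when it exists, and is set to `0` when it does not exist. -/
def operatorOfFormula (F : L1 → Plane → ℝ) : L1 →L[ℝ] L1 :=
  open scoped Classical in
  if h : ∃ S : L1 →L[ℝ] L1, ∀ u : L1, S u =ᵐ[volume] F u then Classical.choose h else 0

theorem operatorOfFormula_eq {F : L1 → Plane → ℝ} {S : L1 →L[ℝ] L1}
    (hS : ∀ u : L1, S u =ᵐ[volume] F u) : operatorOfFormula F = S := by
  have h : ∃ S : L1 →L[ℝ] L1, ∀ u : L1, S u =ᵐ[volume] F u := ⟨S, hS⟩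
  rw [operatorOfFormula, dif_pos h]
  ext1 u
  exact Lp.ext ((Classical.choose_spec h u).trans (hS u).symm)

/-- The heat kernel `K(t, x)` of `ε² Δ` on `ℝ²`, for `t > 0`. -/
def heatKernel (ε t : ℝ) (x : Plane) : ℝ :=
  1 / (4 * Real.pi * ε ^ 2 * t) * Real.exp (-‖x‖ ^ 2 / (4 * ε ^ 2 * t))

/-- The heat semigroup `T_{ε²Δ}(t)` on `L¹(ℝ²)`: convolution with the heat kernel for `t > 0`, and
the identity for `t = 0`. -/
def heatSemigroup (ε : ℝ) (t : ℝ) : L1 →L[ℝ] L1 :=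
  operatorOfFormula fun u x => if 0 < t then ∫ z, heatKernel ε t (x - z) * u z else u x

/-- The flow `Π(t) z` on `ℝ²` generated by `C`: the curve through `z` at time `0` with
`∂ₜ Π(t) z = C (Π(t) z)` for all `t ∈ ℝ`. It exists and is unique for bounded Lipschitz `C`; the
value is arbitrary if no global curve exists. -/
def flow (C : Plane → Plane) (t : ℝ) (z : Plane) : Plane :=
  open scoped Classical in
  if h : ∃ γ : ℝ → Plane, γ 0 = z ∧ ∀ s, HasDerivAt γ (C (γ s)) s then Classical.choose h t else z

/-- The convection semigroup `T_B(t)` on `L¹(ℝ²)`, given by integration along characteristics: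
`T_B(t)(v)(x) = exp (-∫₀ᵗ (div C)(Π(-σ) x) dσ) * v (Π(-t) x)`. -/
def convectionSemigroup (C : Plane → Plane) (t : ℝ) : L1 →L[ℝ] L1 :=
  operatorOfFormula fun v x =>
    Real.exp (-∫ σ in (0 : ℝ)..t, divergence C (flow C (-σ) x)) * v (flow C (-t) x)

/-- The operator `A`, the realization of `ε² Δ` in `L¹(ℝ²)`: the generator of the heat
semigroup. -/
def diffusionOperator (ε : ℝ) : L1 →ₗ.[ℝ] L1 := generator (heatSemigroup ε)

/-- The operator `B`, the realization of `v ↦ -∇·(v C)` in `L¹(ℝ²)`: the generator of the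
convection semigroup. -/
def convectionOperator (C : Plane → Plane) : L1 →ₗ.[ℝ] L1 := generator (convectionSemigroup C)

end ReturnHome

end

/-!
The proof constructs `T` by the Hille–Yosida theorem and reads off positivity from dissipativity.
Write `G` for the heat semigroup, `S` for the convection semigroup, `A` and `B` for their
generators.

*Smoothing.* The only link between the two semigroups is the estimate
`‖(S h - 1) (G t u)‖ ≤ h * c * (1 + t ^ (-1/2)) * ‖u‖` for `0 < h ≤ 1`, together with
`G t u ∈ D(B)` for `t > 0`. Since `G t u` is the `L¹`-valued integral `∫ u(z) K(t, · - z) dz` of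
translated Gaussians, both have to be checked on a single Gaussian `w` only. There the difference
`S h w - w` is the integral over `[0, h]` of `S s` applied to `-∇·(w C)`
(`hasDerivAt_convection_gauss`), and `|∇·(w C)|` is at most `c (1 + t ^ (-1/2))` times a wider
Gaussian (`abs_gaussFlux_le`). Boundedness of `S h` needs no Jacobian: the flow at time `-h` is
antilipschitz with constant `exp (K h)` by Gronwall, so it distorts area by at most `exp (2 K h)`
(`map_backflow_le`).

*Perturbation.* The resolvent of `A` is the Laplace transform of `G`. Dominated convergence in the
Laplace integral gives `D(A) ⊆ D(B)`, and `‖B (λ - A)⁻¹‖ < 1` for large `λ`, so that `λ - A - B` is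
surjective by a Neumann series (`exists_semigroup_add`).

*Dissipativity.* For `u ∈ D(A)`, `G h (S h u) = u + h (A + B) u + o(h)`. If `p` is a sublinear
functional below the norm with `p (G h (S h u)) ≤ exp (ω h) * p u`, then
`(λ - ω) * p u ≤ p (λ u - (A + B) u)` (`IsDominatedSublinear.dissipative`). With `p` the norm this is
the resolvent bound of Hille–Yosida (`exists_semigroup_of_dissipative`); with `p u = ‖u⁻‖` it says
that the resolvents of `A + B` are positive, and so is `T`, the limit of the exponentials of the
Yosida approximants. Uniqueness of mild solutions is Gronwall's inequality for the norm of the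
integrated difference of two solutions (`IsC0Semigroup.isMildSolution_iff`).
-/

noncomputable section

namespace ReturnHome

section Abstract

variable {X : Type*} [NormedAddCommGroup X] [NormedSpace ℝ X]

/-! ### Dissipativity and strongly continuous semigroups -/

/-- A sublinear functional bounded above by the norm. The norm itself and, on `L¹`, the norm of the
negative part are the two instances of interest. -/
structure IsDominatedSublinear (p : X → ℝ) : Prop where
  add_le : ∀ u v, p (u + v) ≤ p u + p v
  smul_eq : ∀ (c : ℝ) (u : X), 0 ≤ c → p (c • u) = c * p u
  le_norm : ∀ u, p u ≤ ‖u‖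

theorem isDominatedSublinear_norm : IsDominatedSublinear (fun u : X => ‖u‖) where
  add_le := norm_add_le
  smul_eq c u hc := by rw [norm_smul, Real.norm_of_nonneg hc]
  le_norm _ := le_rfl

theorem tendsto_inv_mul_exp_sub_one (ω : ℝ) :
    Tendsto (fun h : ℝ => h⁻¹ * (Real.exp (ω * h) - 1)) (𝓝[>] 0) (𝓝 ω) := by
  have h1 : HasDerivAt (fun h : ℝ => Real.exp (ω * h)) ω 0 := by
    simpa using ((hasDerivAt_id (0 : ℝ)).const_mul ω).exp
  have h2 := h1.tendsto_slope_zero_right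
  simpa using h2

/-- If `F h = u + h f + o(h)` and `p (F h) ≤ exp (ω h) * p u`, then `u`, `f` satisfy the dissipativity
inequality for `p`. The path `F` need not be the orbit of a semigroup: for a sum of generators it is
the product of the two semigroups. -/
theorem IsDominatedSublinear.dissipative {p : X → ℝ} (hp : IsDominatedSublinear p)
    {ω lam : ℝ} {F : ℝ → X} {u f : X}
    (hF : ∀ᶠ h in 𝓝[>] (0 : ℝ), p (F h) ≤ Real.exp (ω * h) * p u)
    (hlim : Tendsto (fun h : ℝ => h⁻¹ • (F h - u)) (𝓝[>] 0) (𝓝 f)) (hlam : 0 ≤ lam) :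
    (lam - ω) * p u ≤ p (lam • u - f) := by
  have key : ∀ᶠ h in 𝓝[>] (0 : ℝ),
      lam * p u - (h⁻¹ * (Real.exp (ω * h) - 1)) * p u
        ≤ p (lam • u - f) + ‖h⁻¹ • (F h - u) - f‖ := by
    filter_upwards [hF, self_mem_nhdsWithin] with h hFh hh
    have hh : 0 < h := hh
    -- `u + λhu` is `F h` plus `h (λu - f)`, up to the `o(h)` remainder
    have e1 : (1 + lam * h) • u = F h + (h • (lam • u - f) + (h • (f - h⁻¹ • (F h - u)))) := by
      simp only [smul_sub, smul_smul, add_smul, one_smul, mul_inv_cancel₀ hh.ne', mul_comm lam h]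
      abel
    have e2 : (1 + lam * h) * p u ≤ Real.exp (ω * h) * p u
        + (h * p (lam • u - f) + h * ‖h⁻¹ • (F h - u) - f‖) := by
      rw [← hp.smul_eq _ _ (by positivity), e1]
      refine (hp.add_le _ _).trans (add_le_add hFh ((hp.add_le _ _).trans (add_le_add ?_ ?_)))
      · rw [hp.smul_eq _ _ hh.le]
      · rw [hp.smul_eq _ _ hh.le, norm_sub_rev]
        exact mul_le_mul_of_nonneg_left (hp.le_norm _) hh.le
    have e3 := mul_le_mul_of_nonneg_left e2 (inv_nonneg.2 hh.le)
    have e4 : h⁻¹ * h = 1 := inv_mul_cancel₀ hh.ne'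
    linear_combination e3 - (lam * p u - p (lam • u - f) - ‖h⁻¹ • (F h - u) - f‖) * e4
  have l1 : Tendsto (fun h : ℝ => lam * p u - (h⁻¹ * (Real.exp (ω * h) - 1)) * p u) (𝓝[>] 0)
      (𝓝 (lam * p u - ω * p u)) :=
    ((tendsto_inv_mul_exp_sub_one ω).mul_const _).const_sub _
  have l2 : Tendsto (fun h : ℝ => p (lam • u - f) + ‖h⁻¹ • (F h - u) - f‖) (𝓝[>] 0)
      (𝓝 (p (lam • u - f) + 0)) := by
    refine Tendsto.const_add _ ?_
    exact tendsto_iff_norm_sub_tendsto_zero.1 hlim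
  have := le_of_tendsto_of_tendsto l1 l2 key
  linarith

/-- Strong continuity at `0` and local boundedness suffice for strong continuity. -/
theorem IsC0Semigroup.of_tendsto_zero {T : ℝ → X →L[ℝ] X} (zero : T 0 = ContinuousLinearMap.id ℝ X)
    (add : ∀ s t : ℝ, 0 ≤ s → 0 ≤ t → T (s + t) = (T s).comp (T t))
    (bdd : ∀ τ : ℝ, ∃ M : ℝ, ∀ t, 0 ≤ t → t ≤ τ → ‖T t‖ ≤ M)
    (tendsto : ∀ u, Tendsto (fun t => T t u) (𝓝[>] 0) (𝓝 u)) : IsC0Semigroup T := by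
  refine ⟨zero, add, fun u t ht => ?_⟩
  obtain ⟨M, hM⟩ := bdd (t + 1)
  have hg : Tendsto (fun s => M * ‖T |s - t| u - u‖) (𝓝[Ici 0] t) (𝓝 0) := by
    have h1 : Tendsto (fun t => T t u) (𝓝[≥] 0) (𝓝 u) := by
      rw [← Ioi_insert, nhdsWithin_insert, tendsto_sup]
      refine ⟨?_, tendsto u⟩
      rw [tendsto_pure_left]
      intro s hs
      simpa [zero] using mem_of_mem_nhds hs
    have h2 : Tendsto (fun s => |s - t|) (𝓝[Ici 0] t) (𝓝[≥] 0) := by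
      refine tendsto_nhdsWithin_iff.2 ⟨?_, Eventually.of_forall fun s => mem_Ici.2 (abs_nonneg _)⟩
      have : Continuous fun s : ℝ => |s - t| := by fun_prop
      simpa using (this.tendsto t).mono_left nhdsWithin_le_nhds
    simpa using (tendsto_iff_norm_sub_tendsto_zero.1 (h1.comp h2)).const_mul M
  refine tendsto_iff_norm_sub_tendsto_zero.2 (squeeze_zero' (Eventually.of_forall fun _ =>
    norm_nonneg _) ?_ hg)
  have hev : ∀ᶠ s in 𝓝[Ici 0] t, s < t + 1 :=
    nhdsWithin_le_nhds (Iio_mem_nhds (by linarith))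
  have aux : ∀ a b : ℝ, 0 ≤ a → a ≤ b → b ≤ t + 1 → ‖T b u - T a u‖ ≤ M * ‖T |b - a| u - u‖ := by
    intro a b ha hab hb
    have e : T b u - T a u = T a (T |b - a| u - u) := by
      rw [map_sub, ← ContinuousLinearMap.comp_apply, ← add _ _ ha (abs_nonneg _),
        abs_of_nonneg (by linarith)]
      simp
    rw [e]
    exact (T a).le_of_opNorm_le (hM a ha (by linarith)) _
  filter_upwards [hev, self_mem_nhdsWithin] with s hs hs0
  rcases le_total t s with h | h
  · exact aux t s ht h hs.le
  · rw [norm_sub_rev, abs_sub_comm]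
    exact aux s t hs0 h (by linarith)

theorem IsC0Semigroup.continuous_orbit {T : ℝ → X →L[ℝ] X} (hT : IsC0Semigroup T) (u : X) :
    Continuous fun s : ℝ => T (max s 0) u :=
  (hT.continuousOn u).comp_continuous (by fun_prop) fun s => le_max_right s 0

theorem IsC0Semigroup.tendsto_zero {T : ℝ → X →L[ℝ] X} (hT : IsC0Semigroup T) (u : X) :
    Tendsto (fun t => T t u) (𝓝[>] 0) (𝓝 u) := by
  have h : Tendsto (fun t => T t u) (𝓝[≥] 0) (𝓝 (T 0 u)) := hT.continuousOn u 0 self_mem_Ici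
  rw [hT.zero] at h
  exact h.mono_left (nhdsWithin_mono _ Ioi_subset_Ici_self)

theorem generator_eq {T : ℝ → X →L[ℝ] X} {u : X} {f : X} (h : IsGeneratorValue T u f)
    (hu : u ∈ (generator T).domain) : generator T ⟨u, hu⟩ = f :=
  tendsto_nhds_unique (generator_spec T ⟨u, hu⟩) h

/-! ### Integrals of orbits: density of the domain, mild solutions, resolvents -/

theorem tendsto_inv_smul_intervalIntegral [CompleteSpace X] {f : ℝ → X} (hf : Continuous f) (t : ℝ) :
    Tendsto (fun h : ℝ => h⁻¹ • ∫ s in t..(t + h), f s) (𝓝[>] 0) (𝓝 (f t)) := by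
  have h1 := (hf.integral_hasStrictDerivAt t t).hasDerivAt.tendsto_slope_zero_right
  simpa using h1

theorem IsC0Semigroup.intervalIntegrable {T : ℝ → X →L[ℝ] X} (hT : IsC0Semigroup T) (u : X)
    {a b : ℝ} (ha : 0 ≤ a) (hb : 0 ≤ b) : IntervalIntegrable (fun s => T s u) volume a b := by
  refine ContinuousOn.intervalIntegrable ((hT.continuousOn u).mono fun s hs => ?_)
  exact (le_min ha hb).trans hs.1

/-- Extending an orbit by the constant `u` to negative times makes it continuous on the whole line
without affecting integrals over nonnegative times. -/
theorem intervalIntegral_orbit_eq {T : ℝ → X →L[ℝ] X} (u : X)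
    {a b : ℝ} (ha : 0 ≤ a) (hb : 0 ≤ b) : ∫ s in a..b, T s u = ∫ s in a..b, T (max s 0) u := by
  refine intervalIntegral.integral_congr fun s hs => ?_
  have : 0 ≤ s := (le_min ha hb).trans hs.1
  simp [max_eq_left this]

/-- The generator maps `∫₀ᵗ T(s) u ds` to `T(t) u - u`. -/
theorem IsC0Semigroup.isGeneratorValue_integral [CompleteSpace X] {T : ℝ → X →L[ℝ] X}
    (hT : IsC0Semigroup T) (u : X) {t : ℝ} (ht : 0 ≤ t) :
    IsGeneratorValue T (∫ s in (0 : ℝ)..t, T s u) (T t u - u) := by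
  have hc := hT.continuous_orbit u
  have h1 := tendsto_inv_smul_intervalIntegral hc t
  have h2 := tendsto_inv_smul_intervalIntegral hc 0
  simp only [max_eq_left ht, max_self, hT.zero, zero_add, ContinuousLinearMap.id_apply] at h1 h2
  refine (h1.sub h2).congr' ?_
  filter_upwards [self_mem_nhdsWithin] with h hh
  have hh : 0 < h := hh
  rw [← smul_sub]
  congr 1
  have e1 : T h (∫ s in (0 : ℝ)..t, T s u) = ∫ s in h..(t + h), T (max s 0) u := by
    rw [← ContinuousLinearMap.intervalIntegral_comp_comm _ (hT.intervalIntegrable u le_rfl ht),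
      ← intervalIntegral_orbit_eq u hh.le (by positivity)]
    have := intervalIntegral.integral_comp_add_right (a := 0) (b := t) (fun s => T s u) h
    rw [zero_add] at this
    rw [← this]
    refine intervalIntegral.integral_congr fun s hs => ?_
    have hs : 0 ≤ s := (le_min le_rfl ht).trans hs.1
    rw [add_comm s h, hT.add h s hh.le hs, ContinuousLinearMap.comp_apply]
  rw [e1, intervalIntegral_orbit_eq u le_rfl ht]
  have i : ∀ a b, IntervalIntegrable (fun s : ℝ => T (max s 0) u) volume a b :=
    fun a b => hc.intervalIntegrable a b
  have e2 := intervalIntegral.integral_add_adjacent_intervals (i 0 h) (i h (t + h))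
  have e3 := intervalIntegral.integral_add_adjacent_intervals (i 0 t) (i t (t + h))
  rw [← e3] at e2
  rw [sub_eq_sub_iff_add_eq_add, add_comm, add_comm _ (∫ s in (0 : ℝ)..h, _), e2]

theorem IsC0Semigroup.dense_domain [CompleteSpace X] {T : ℝ → X →L[ℝ] X}
    (hT : IsC0Semigroup T) : Dense ((generator T).domain : Set X) := by
  intro u
  have h2 := tendsto_inv_smul_intervalIntegral (hT.continuous_orbit u) 0
  simp only [max_self, hT.zero, zero_add, ContinuousLinearMap.id_apply] at h2
  refine mem_closure_of_tendsto h2 ?_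
  filter_upwards [self_mem_nhdsWithin] with h hh
  have hh : 0 < h := hh
  refine Submodule.smul_mem _ _ ?_
  rw [← intervalIntegral_orbit_eq u le_rfl hh.le]
  exact ⟨_, hT.isGeneratorValue_integral u hh.le⟩

/-- For a quasi-contractive semigroup the orbits are exactly the mild solutions. For uniqueness, let
`W` be the integral of the difference of two solutions. Then `W' = G W`, hence
`W (s + h) = T h (W s) + o(h)`, and Gronwall's inequality for `‖W‖` gives `W = 0`. -/
theorem IsC0Semigroup.isMildSolution_iff [CompleteSpace X] {T : ℝ → X →L[ℝ] X}
    (hT : IsC0Semigroup T) {ω : ℝ} (hω : ∀ t, 0 ≤ t → ‖T t‖ ≤ Real.exp (ω * t))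
    (v₀ : X) (v : ℝ → X) :
    IsMildSolution (generator T) v₀ v ↔ ∀ t : ℝ, 0 ≤ t → v t = T t v₀ := by
  constructor
  · rintro ⟨hv, hmild⟩
    -- the difference of the two solutions, continuous on the whole line
    set w : ℝ → X := fun s => v (max s 0) - T (max s 0) v₀ with hw
    have hwc : Continuous w := (hv.comp_continuous (by fun_prop) fun s => le_max_right s 0).sub
      (hT.continuous_orbit v₀)
    set W : ℝ → X := fun t => ∫ s in (0 : ℝ)..t, w s with hW
    have hWd : ∀ t, HasDerivAt W (w t) t := fun t => (hwc.integral_hasStrictDerivAt 0 t).hasDerivAt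
    have hWg : ∀ t, 0 ≤ t → IsGeneratorValue T (W t) (w t) := by
      intro t ht
      obtain ⟨h1, h2⟩ := hmild t ht
      have g1 := generator_spec T ⟨_, h1⟩
      have g2 := hT.isGeneratorValue_integral v₀ ht
      have e1 : W t = (∫ s in (0 : ℝ)..t, v s) - ∫ s in (0 : ℝ)..t, T s v₀ := by
        rw [← intervalIntegral.integral_sub
          (ContinuousOn.intervalIntegrable (hv.mono fun s hs => (le_min le_rfl ht).trans hs.1))
          (hT.intervalIntegrable v₀ le_rfl ht)]
        refine intervalIntegral.integral_congr fun s hs => ?_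
        have hs : 0 ≤ s := (le_min le_rfl ht).trans hs.1
        simp [hw, max_eq_left hs]
      have e2 : w t = generator T ⟨_, h1⟩ - (T t v₀ - v₀) := by
        simp only [hw, max_eq_left ht, h2]
        abel
      rw [e1, e2]
      refine (Tendsto.sub g1 g2).congr fun h => ?_
      rw [← smul_sub, map_sub]
      congr 1
      abel
    have hW0 : ∀ t, 0 ≤ t → W t = 0 := by
      intro t ht
      have := le_gronwallBound_of_liminf_deriv_right_le (f := fun s => ‖W s‖)
        (f' := fun s => ω * ‖W s‖) (δ := 0) (K := ω) (ε := 0) (a := 0) (b := t)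
        (fun s _ => (hWd s).continuousAt.norm.continuousWithinAt) ?_ (by simp [hW]) (by simp) t
        ⟨ht, le_rfl⟩
      · simpa [gronwallBound_ε0_δ0] using this
      intro x hx r hr
      have l1 : Tendsto (fun h : ℝ => (h⁻¹ * (Real.exp (ω * h) - 1)) * ‖W x‖
          + ‖h⁻¹ • (W (x + h) - W x) - h⁻¹ • (T h (W x) - W x)‖) (𝓝[>] 0)
          (𝓝 (ω * ‖W x‖ + ‖w x - w x‖)) :=
        ((tendsto_inv_mul_exp_sub_one ω).mul_const _).add
          (((hWd x).tendsto_slope_zero_right).sub (hWg x hx.1)).norm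
      rw [sub_self, norm_zero, add_zero] at l1
      have ev : ∀ᶠ h in 𝓝[>] (0 : ℝ), h⁻¹ * (‖W (x + h)‖ - ‖W x‖) < r := by
        filter_upwards [l1.eventually_lt_const hr, self_mem_nhdsWithin] with h h1 hh
        have hh : 0 < h := hh
        refine lt_of_le_of_lt ?_ h1
        rw [← smul_sub, norm_smul, Real.norm_of_nonneg (inv_nonneg.2 hh.le), mul_assoc, ← mul_add]
        refine mul_le_mul_of_nonneg_left ?_ (inv_nonneg.2 hh.le)
        have a1 : ‖T h (W x)‖ ≤ Real.exp (ω * h) * ‖W x‖ :=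
          (T h).le_of_opNorm_le (hω h hh.le) _
        have a2 := norm_sub_norm_le (W (x + h)) (T h (W x))
        have a3 : W (x + h) - W x - (T h (W x) - W x) = W (x + h) - T h (W x) := by abel
        rw [a3]
        linarith
      have ev2 : ∀ᶠ z in 𝓝[>] x, (z - x)⁻¹ * (‖W z‖ - ‖W x‖) < r := by
        have hm : Tendsto (fun z => z - x) (𝓝[>] x) (𝓝[>] 0) := by
          refine tendsto_nhdsWithin_iff.2 ⟨?_, ?_⟩
          · have : Continuous fun z : ℝ => z - x := by fun_prop
            simpa using (this.tendsto x).mono_left nhdsWithin_le_nhds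
          · filter_upwards [self_mem_nhdsWithin] with z hz
            exact sub_pos.2 (mem_Ioi.1 hz)
        simpa using hm.eventually ev
      exact ev2.frequently
    intro t ht
    have h1 : IsGeneratorValue T 0 (w t) := hW0 t ht ▸ hWg t ht
    have h2 : IsGeneratorValue T 0 0 := by simp [IsGeneratorValue]
    have h3 : w t = 0 := tendsto_nhds_unique h1 h2
    simpa [hw, max_eq_left ht, sub_eq_zero] using h3
  · intro h
    refine ⟨(hT.continuousOn v₀).congr fun t ht => h t ht, fun t ht => ?_⟩
    have e : ∫ s in (0 : ℝ)..t, v s = ∫ s in (0 : ℝ)..t, T s v₀ :=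
      intervalIntegral.integral_congr fun s hs => h s ((le_min le_rfl ht).trans hs.1)
    have g := hT.isGeneratorValue_integral v₀ ht
    rw [← e] at g
    exact ⟨⟨_, g⟩, by rw [h t ht]; exact (add_eq_of_eq_sub' (generator_eq g _)).symm⟩

/-- The Laplace transform `∫₀^∞ e^{-λt} T(t) u dt` of the orbit of `u`. -/
def laplace (T : ℝ → X →L[ℝ] X) (lam : ℝ) (u : X) : X :=
  ∫ t in Ioi (0 : ℝ), Real.exp (-lam * t) • T t u

theorem IsC0Semigroup.integrableOn_laplace {T : ℝ → X →L[ℝ] X}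
    (hT : IsC0Semigroup T) (hb : ∀ t, 0 ≤ t → ‖T t‖ ≤ 1) {lam : ℝ} (hlam : 0 < lam) (u : X) :
    IntegrableOn (fun t => Real.exp (-lam * t) • T t u) (Ioi 0) := by
  have h1 : IntegrableOn (fun t => Real.exp (-lam * t) * ‖u‖) (Ioi 0) :=
    (integrableOn_exp_mul_Ioi (by linarith) 0).mul_const _
  refine h1.mono' ?_ ?_
  · refine ContinuousOn.aestronglyMeasurable ?_ measurableSet_Ioi
    exact (by fun_prop : Continuous fun t : ℝ => Real.exp (-lam * t)).continuousOn.smul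
      ((hT.continuousOn u).mono Ioi_subset_Ici_self)
  · filter_upwards [ae_restrict_mem measurableSet_Ioi] with t ht
    rw [norm_smul, Real.norm_of_nonneg (Real.exp_pos _).le]
    refine mul_le_mul_of_nonneg_left ?_ (Real.exp_pos _).le
    simpa using (T t).le_of_opNorm_le (hb t (le_of_lt ht)) u

/-- The Laplace transform solves the resolvent equation `(λ - G) w = u`. -/
theorem IsC0Semigroup.isGeneratorValue_laplace [CompleteSpace X] {T : ℝ → X →L[ℝ] X}
    (hT : IsC0Semigroup T) (hb : ∀ t, 0 ≤ t → ‖T t‖ ≤ 1) {lam : ℝ} (hlam : 0 < lam) (u : X) :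
    IsGeneratorValue T (laplace T lam u) (lam • laplace T lam u - u) := by
  have hi := hT.integrableOn_laplace hb hlam u
  set g : ℝ → X := fun t => Real.exp (-lam * t) • T (max t 0) u with hg
  have hgc : Continuous g := (by fun_prop : Continuous fun t : ℝ => Real.exp (-lam * t)).smul
    (hT.continuous_orbit u)
  have hl : laplace T lam u = ∫ t in Ioi (0 : ℝ), g t :=
    setIntegral_congr_fun measurableSet_Ioi fun t ht => by simp [hg, max_eq_left (le_of_lt (mem_Ioi.1 ht))]
  have hgi : IntegrableOn g (Ioi 0) :=
    hi.congr_fun (fun t ht => by simp [hg, max_eq_left (le_of_lt (mem_Ioi.1 ht))]) measurableSet_Ioi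
  have l1 := tendsto_inv_smul_intervalIntegral hgc 0
  simp only [hg, mul_zero, Real.exp_zero, max_self, hT.zero, zero_add, one_smul,
    ContinuousLinearMap.id_apply] at l1
  have l2 : Tendsto (fun h : ℝ => Real.exp (lam * h)) (𝓝[>] 0) (𝓝 1) := by
    have : Continuous fun h : ℝ => Real.exp (lam * h) := by fun_prop
    simpa using (this.tendsto 0).mono_left nhdsWithin_le_nhds
  have l3 := ((tendsto_inv_mul_exp_sub_one lam).smul_const (laplace T lam u)).sub (l2.smul l1)
  rw [one_smul] at l3
  refine l3.congr' ?_
  filter_upwards [self_mem_nhdsWithin] with h hh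
  have hh : 0 < h := hh
  have e1 : T h (laplace T lam u) = Real.exp (lam * h) • ∫ t in Ioi h, g t := by
    rw [laplace, ← ContinuousLinearMap.integral_comp_comm _ hi]
    have : MeasurePreserving (fun t : ℝ => t + h) volume volume := measurePreserving_add_right _ h
    have hp : (fun t : ℝ => t + h) ⁻¹' Ioi h = Ioi 0 := by ext; simp
    rw [← integral_smul, ← this.setIntegral_preimage_emb (measurableEmbedding_addRight h) _ (Ioi h), hp]
    refine setIntegral_congr_fun measurableSet_Ioi fun t ht => ?_
    have ht : 0 < t := ht
    simp only [hg]
    rw [max_eq_left (by positivity), add_comm t h, hT.add h t hh.le ht.le, smul_smul,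
      ← Real.exp_add, map_smul, ContinuousLinearMap.comp_apply]
    congr 2
    ring
  have e2 := intervalIntegral.integral_interval_add_Ioi (hgi) (hgi.mono_set (Ioi_subset_Ioi hh.le))
  rw [e1, eq_sub_of_add_eq' e2, ← hl]
  module

/-! ### Limits of exponentials of commuting bounded operators -/

theorem norm_exp_le_exp_norm [CompleteSpace X] (A : X →L[ℝ] X) :
    ‖NormedSpace.exp A‖ ≤ Real.exp ‖A‖ := by
  rw [NormedSpace.exp_eq_tsum ℝ, Real.exp_eq_exp_ℝ, NormedSpace.exp_eq_tsum ℝ]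
  have hs : Summable fun n : ℕ => ((n.factorial : ℝ)⁻¹) • ‖A‖ ^ n :=
    NormedSpace.expSeries_summable' (𝕂 := ℝ) ‖A‖
  refine tsum_of_norm_bounded hs.hasSum fun n => ?_
  rw [norm_smul, smul_eq_mul, Real.norm_of_nonneg (by positivity)]
  refine mul_le_mul_of_nonneg_left ?_ (by positivity)
  rcases n with _ | n
  · rw [pow_zero, pow_zero]
    exact ContinuousLinearMap.norm_id_le
  · exact norm_pow_le' A n.succ_pos

/-- The estimate comes from differentiating `s ↦ exp (s A) exp ((t - s) B) u`. -/
theorem norm_exp_sub_exp_le [CompleteSpace X] {A B : X →L[ℝ] X} (hAB : Commute A B) {ω : ℝ}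
    (hA : ∀ t : ℝ, 0 ≤ t → ‖NormedSpace.exp (t • A)‖ ≤ Real.exp (ω * t))
    (hB : ∀ t : ℝ, 0 ≤ t → ‖NormedSpace.exp (t • B)‖ ≤ Real.exp (ω * t)) {t : ℝ} (ht : 0 ≤ t)
    (u : X) :
    ‖NormedSpace.exp (t • A) u - NormedSpace.exp (t • B) u‖
      ≤ Real.exp (ω * t) * ‖A u - B u‖ * t := by
  set ψ : ℝ → X := fun s => (NormedSpace.exp (s • A) * NormedSpace.exp ((t - s) • B)) u with hψ
  have hd : ∀ s, HasDerivAt ψ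
      ((NormedSpace.exp (s • A) * NormedSpace.exp ((t - s) • B)) (A u - B u)) s := by
    intro s
    have h1 := hasDerivAt_exp_smul_const (𝕂 := ℝ) A s
    have h2 : HasDerivAt (fun r : ℝ => NormedSpace.exp ((t - r) • B))
        (-(NormedSpace.exp ((t - s) • B) * B)) s := by
      have h := (hasDerivAt_exp_smul_const (𝕂 := ℝ) B (t - s)).scomp s
        ((hasDerivAt_id s).const_sub t)
      rw [neg_one_smul] at h
      exact h
    have h3 := ((ContinuousLinearMap.apply ℝ X u).hasFDerivAt.comp_hasDerivAt s (h1.mul h2))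
    refine h3.congr_deriv ?_
    change _ = (NormedSpace.exp (s • A) * NormedSpace.exp ((t - s) • B) * (A - B)) u
    have hc : NormedSpace.exp ((t - s) • B) * A = A * NormedSpace.exp ((t - s) • B) :=
      (((hAB.smul_right (t - s)).exp_right).eq).symm
    rw [ContinuousLinearMap.apply_apply, mul_neg, mul_assoc, mul_assoc, ← hc, ← sub_eq_add_neg, ← mul_sub, ← mul_sub]
  have := norm_image_sub_le_of_norm_deriv_le_segment' (a := 0) (b := t)
    (C := Real.exp (ω * t) * ‖A u - B u‖) (fun s _ => (hd s).hasDerivWithinAt) ?_ t ⟨ht, le_rfl⟩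
  · simpa [hψ] using this
  · intro s hs
    refine ContinuousLinearMap.le_of_opNorm_le _ ?_ _
    refine (norm_mul_le _ _).trans ?_
    have e : Real.exp (ω * t) = Real.exp (ω * s) * Real.exp (ω * (t - s)) := by
      rw [← Real.exp_add]; congr 1; ring
    rw [e]
    exact mul_le_mul (hA s hs.1) (hB _ (by linarith [hs.2])) (norm_nonneg _) (Real.exp_pos _).le

/-- For eventually bounded operators strong convergence need be checked on a dense set only. -/
theorem tendsto_of_dense {ι : Type*} {l : Filter ι} {A : ι → X →L[ℝ] X} {B : X →L[ℝ] X} {M : ℝ}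
    (hA : ∀ᶠ i in l, ‖A i‖ ≤ M) {D : Set X} (hD : Dense D)
    (h : ∀ u ∈ D, Tendsto (fun i => A i u) l (𝓝 (B u))) (u : X) :
    Tendsto (fun i => A i u) l (𝓝 (B u)) := by
  rw [Metric.tendsto_nhds]
  intro ε hε
  set K := |M| + ‖B‖ + 1 with hK
  have hKp : 0 < K := by positivity
  obtain ⟨v, hv, hvu⟩ := Metric.dense_iff.1 hD u (ε / 2 / K) (by positivity)
  rw [mem_ball_iff_norm] at hv
  filter_upwards [hA, Metric.tendsto_nhds.1 (h v hvu) (ε / 2) (by positivity)] with i h1 h2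
  rw [dist_eq_norm] at h2 ⊢
  have e : A i u - B u = (A i v - B v) + (B (v - u) - A i (v - u)) := by
    simp only [map_sub]; abel
  have h3 : ‖B (v - u) - A i (v - u)‖ ≤ K * ‖v - u‖ := by
    refine (norm_sub_le _ _).trans ?_
    have a1 := B.le_opNorm (v - u)
    have a2 := (A i).le_of_opNorm_le (h1.trans (le_abs_self M)) (v - u)
    rw [hK]
    nlinarith [norm_nonneg (v - u)]
  have h4 : K * ‖v - u‖ < ε / 2 := by
    rw [mul_comm]; exact (lt_div_iff₀ hKp).1 hv
  rw [e]
  exact (norm_add_le _ _).trans_lt (by linarith)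

theorem cauchySeq_of_dense {A : ℕ → X →L[ℝ] X} {M : ℝ}
    (hA : ∀ n, ‖A n‖ ≤ M) {D : Set X} (hD : Dense D)
    (h : ∀ u ∈ D, CauchySeq fun n => A n u) (u : X) : CauchySeq fun n => A n u := by
  have hM : 0 ≤ M := (norm_nonneg _).trans (hA 0)
  rw [Metric.cauchySeq_iff]
  intro ε hε
  set K := 2 * M + 1 with hK
  have hKp : 0 < K := by positivity
  obtain ⟨v, hv, hvu⟩ := Metric.dense_iff.1 hD u (ε / 2 / K) (by positivity)
  rw [mem_ball_iff_norm] at hv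
  obtain ⟨N, hN⟩ := Metric.cauchySeq_iff.1 (h v hvu) (ε / 2) (by positivity)
  refine ⟨N, fun m hm n hn => ?_⟩
  have h2 := hN m hm n hn
  rw [dist_eq_norm] at h2 ⊢
  have e : A m u - A n u = (A m v - A n v) + (A n (v - u) - A m (v - u)) := by
    simp only [map_sub]; abel
  have h3 : ‖A n (v - u) - A m (v - u)‖ ≤ K * ‖v - u‖ := by
    refine (norm_sub_le _ _).trans ?_
    have a1 := (A n).le_of_opNorm_le (hA n) (v - u)
    have a2 := (A m).le_of_opNorm_le (hA m) (v - u)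
    rw [hK]
    nlinarith [norm_nonneg (v - u)]
  have h4 : K * ‖v - u‖ < ε / 2 := by
    rw [mul_comm]; exact (lt_div_iff₀ hKp).1 hv
  rw [e]
  exact (norm_add_le _ _).trans_lt (by linarith)

theorem tendsto_apply_of_bounded {A : ℕ → X →L[ℝ] X} {M : ℝ} (hA : ∀ n, ‖A n‖ ≤ M)
    {x : ℕ → X} {a b : X} (hx : Tendsto x atTop (𝓝 a))
    (ha : Tendsto (fun n => A n a) atTop (𝓝 b)) : Tendsto (fun n => A n (x n)) atTop (𝓝 b) := by
  have h0 : Tendsto (fun n => A n (x n - a)) atTop (𝓝 0) := by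
    refine squeeze_zero_norm (fun n => (A n).le_of_opNorm_le (hA n) _) ?_
    simpa using (tendsto_iff_norm_sub_tendsto_zero.1 hx).const_mul M
  simpa using h0.add ha

/-- If commuting bounded operators `A n`, with uniformly quasi-contractive exponentials, converge
strongly to `L` on a dense set, then their exponentials converge strongly to a semigroup whose
generator extends `L`. -/
theorem exists_semigroup_of_tendsto [CompleteSpace X] (A : ℕ → X →L[ℝ] X)
    (hcomm : ∀ m n, Commute (A m) (A n)) {ω : ℝ} (hω : 0 ≤ ω)
    (hb : ∀ (n : ℕ) (t : ℝ), 0 ≤ t → ‖NormedSpace.exp (t • A n)‖ ≤ Real.exp (ω * t))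
    {D : Set X} (hD : Dense D) (L : X → X)
    (hL : ∀ u ∈ D, Tendsto (fun n => A n u) atTop (𝓝 (L u))) :
    ∃ T : ℝ → X →L[ℝ] X, IsC0Semigroup T ∧ (∀ t, 0 ≤ t → ‖T t‖ ≤ Real.exp (ω * t)) ∧
      (∀ u ∈ D, IsGeneratorValue T u (L u)) ∧
      ∀ t, 0 ≤ t → ∀ u, Tendsto (fun n => NormedSpace.exp (t • A n) u) atTop (𝓝 (T t u)) := by
  have hlim : ∀ (t : ℝ) (u : X), ∃ y, 0 ≤ t →
      Tendsto (fun n => NormedSpace.exp (t • A n) u) atTop (𝓝 y) := by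
    intro t u
    by_cases ht : 0 ≤ t
    · have hc : CauchySeq fun n => NormedSpace.exp (t • A n) u := by
        refine cauchySeq_of_dense (fun n => hb n t ht) hD (fun v hv => ?_) u
        have h1 := (hL v hv).cauchySeq
        rw [Metric.cauchySeq_iff] at h1 ⊢
        intro ε hε
        obtain ⟨N, hN⟩ := h1 (ε / (Real.exp (ω * t) * (t + 1))) (by positivity)
        refine ⟨N, fun m hm n hn => ?_⟩
        have h2 := hN m hm n hn
        have h3 := norm_exp_sub_exp_le (hcomm m n) (hb m) (hb n) ht v
        rw [dist_eq_norm] at h2 ⊢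
        rw [lt_div_iff₀ (by positivity)] at h2
        refine h3.trans_lt (lt_of_le_of_lt ?_ h2)
        have : 0 ≤ Real.exp (ω * t) * ‖A m v - A n v‖ := by positivity
        linarith
      obtain ⟨y, hy⟩ := cauchySeq_tendsto_of_complete hc
      exact ⟨y, fun _ => hy⟩
    · exact ⟨0, fun h => absurd h ht⟩
  choose f hf using hlim
  set T : ℝ → X →L[ℝ] X := fun t => if ht : 0 ≤ t then
    continuousLinearMapOfTendsto (fun n => NormedSpace.exp (t • A n)) (f := f t)
      (tendsto_pi_nhds.2 fun u => hf t u ht) else 0 with hT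
  have hTf : ∀ t, 0 ≤ t → ∀ u, T t u = f t u := by
    intro t ht u
    simp only [hT, dif_pos ht]
    rfl
  have hlim : ∀ t, 0 ≤ t → ∀ u, Tendsto (fun n => NormedSpace.exp (t • A n) u) atTop
      (𝓝 (T t u)) := fun t ht u => hTf t ht u ▸ hf t u ht
  have hTb : ∀ t, 0 ≤ t → ‖T t‖ ≤ Real.exp (ω * t) := fun t ht =>
    ContinuousLinearMap.opNorm_le_bound _ (Real.exp_pos _).le fun u =>
      le_of_tendsto (hlim t ht u).norm (Eventually.of_forall fun n =>
        ContinuousLinearMap.le_of_opNorm_le _ (hb n t ht) u)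
  have hzero : T 0 = ContinuousLinearMap.id ℝ X := by
    ext u
    refine tendsto_nhds_unique (hlim 0 le_rfl u) ?_
    simp [NormedSpace.exp_zero]
  have hadd : ∀ s t : ℝ, 0 ≤ s → 0 ≤ t → T (s + t) = (T s).comp (T t) := by
    intro s t hs ht
    ext u
    refine tendsto_nhds_unique (hlim (s + t) (by positivity) u) ?_
    have := tendsto_apply_of_bounded (fun n => hb n s hs) (hlim t ht u) (hlim s hs (T t u))
    refine this.congr fun n => ?_
    let _ : NormedAlgebra ℚ (X →L[ℝ] X) := NormedAlgebra.restrictScalars ℚ ℝ _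
    rw [add_smul, NormedSpace.exp_add_of_commute (((Commute.refl (A n)).smul_left s).smul_right t)]
    rfl
  have hmono : ∀ t τ : ℝ, t ≤ τ → Real.exp (ω * t) ≤ Real.exp (ω * τ) := fun t τ h =>
    Real.exp_le_exp.2 (mul_le_mul_of_nonneg_left h hω)
  have hTc : IsC0Semigroup T := by
    refine IsC0Semigroup.of_tendsto_zero hzero hadd
      (fun τ => ⟨Real.exp (ω * τ), fun t ht h => (hTb t ht).trans (hmono t τ h)⟩) fun u => ?_
    refine tendsto_of_dense (B := ContinuousLinearMap.id ℝ X) (M := Real.exp (ω * 1)) ?_ hD ?_ u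
    · filter_upwards [Ioo_mem_nhdsGT (zero_lt_one' ℝ)] with t ht
      exact (hTb t ht.1.le).trans (hmono t 1 ht.2.le)
    · intro v hv
      refine tendsto_iff_norm_sub_tendsto_zero.2 (squeeze_zero' (Eventually.of_forall fun _ =>
        norm_nonneg _) (g := fun t => Real.exp (ω * t) * ‖L v‖ * t) ?_ ?_)
      · filter_upwards [self_mem_nhdsWithin] with t ht
        have ht : 0 < t := ht
        refine le_of_tendsto_of_tendsto' ((hlim t ht.le v).sub_const v).norm
          (((hL v hv).norm.const_mul _).mul_const _) fun n => ?_
        have := norm_exp_sub_exp_le (Commute.zero_right (A n)) (hb n) (fun s hs => ?_) ht.le v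
        · simpa [NormedSpace.exp_zero] using this
        · rw [smul_zero, NormedSpace.exp_zero]
          exact ContinuousLinearMap.norm_id_le.trans (Real.one_le_exp (by positivity))
      · have : Continuous fun t : ℝ => Real.exp (ω * t) * ‖L v‖ * t := by fun_prop
        simpa using (this.tendsto 0).mono_left nhdsWithin_le_nhds
  refine ⟨T, hTc, hTb, fun u hu => ?_, hlim⟩
  have hint : ∀ t, 0 ≤ t → T t u - u = ∫ s in (0 : ℝ)..t, T s (L u) := by
    intro t ht
    obtain ⟨K, hK⟩ := (hL u hu).norm.bddAbove_range
    refine tendsto_nhds_unique ((hlim t ht u).sub_const u) ?_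
    have h1 : Tendsto (fun n => ∫ s in (0 : ℝ)..t, NormedSpace.exp (s • A n) (A n u)) atTop
        (𝓝 (∫ s in (0 : ℝ)..t, T s (L u))) := by
      refine intervalIntegral.tendsto_integral_filter_of_dominated_convergence
        (fun _ => Real.exp (ω * t) * K) (Eventually.of_forall fun n => ?_)
        (Eventually.of_forall fun n => ?_) intervalIntegrable_const ?_
      · refine Continuous.aestronglyMeasurable ?_
        have : Continuous fun s : ℝ => NormedSpace.exp (s • A n) :=
          continuous_iff_continuousAt.2 fun s =>
            (hasDerivAt_exp_smul_const (𝕂 := ℝ) (A n) s).continuousAt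
        exact this.clm_apply continuous_const
      · refine Eventually.of_forall fun s hs => ?_
        rw [uIoc_of_le ht] at hs
        refine (ContinuousLinearMap.le_of_opNorm_le_of_le _
          ((hb n s hs.1.le).trans (hmono s t hs.2)) (hK ⟨n, rfl⟩))
      · refine Eventually.of_forall fun s hs => ?_
        rw [uIoc_of_le ht] at hs
        exact tendsto_apply_of_bounded (fun n => hb n s hs.1.le) (hL u hu) (hlim s hs.1.le _)
    refine h1.congr fun n => ?_
    have hd : ∀ s : ℝ, HasDerivAt (fun s : ℝ => NormedSpace.exp (s • A n) u)
        (NormedSpace.exp (s • A n) (A n u)) s := fun s =>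
      ((ContinuousLinearMap.apply ℝ X u).hasFDerivAt.comp_hasDerivAt s
        (hasDerivAt_exp_smul_const (𝕂 := ℝ) (A n) s))
    rw [intervalIntegral.integral_eq_sub_of_hasDerivAt (fun s _ => hd s)]
    · simp [NormedSpace.exp_zero]
    · refine Continuous.intervalIntegrable ?_ _ _
      have : Continuous fun s : ℝ => NormedSpace.exp (s • A n) :=
        continuous_iff_continuousAt.2 fun s =>
          (hasDerivAt_exp_smul_const (𝕂 := ℝ) (A n) s).continuousAt
      exact this.clm_apply continuous_const
  have h1 := tendsto_inv_smul_intervalIntegral (hTc.continuous_orbit (L u)) 0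
  simp only [max_self, hTc.zero, zero_add, ContinuousLinearMap.id_apply] at h1
  refine h1.congr' ?_
  filter_upwards [self_mem_nhdsWithin] with h hh
  have hh : 0 < h := hh
  rw [hint h hh.le, intervalIntegral_orbit_eq (T := T) (L u) le_rfl hh.le]

/-! ### Generation of semigroups by dissipative operators -/

/-- A dissipative `L` with `λ - L` surjective has a bounded resolvent at `λ`. -/
theorem exists_resolvent (L : X →ₗ.[ℝ] X) {ω lam : ℝ} (hlam : ω < lam)
    (hdiss : ∀ u : L.domain, (lam - ω) * ‖(u : X)‖ ≤ ‖lam • (u : X) - L u‖)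
    (hsurj : ∀ f, ∃ u : L.domain, lam • (u : X) - L u = f) :
    ∃ R : X →L[ℝ] X, ‖R‖ ≤ (lam - ω)⁻¹ ∧
      (∀ f, ∃ u : L.domain, R f = u ∧ lam • (u : X) - L u = f) ∧
      ∀ u : L.domain, R (lam • (u : X) - L u) = u := by
  have hpos : 0 < lam - ω := sub_pos.2 hlam
  set N : L.domain →ₗ[ℝ] X := lam • L.domain.subtype - L.toFun with hN
  have hNa : ∀ u : L.domain, N u = lam • (u : X) - L u := fun u => rfl
  have hinj : Function.Injective N := by
    rw [← LinearMap.ker_eq_bot, LinearMap.ker_eq_bot']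
    intro u hu
    have h := hdiss u
    rw [← hNa, hu, norm_zero] at h
    have h2 : ‖(u : X)‖ ≤ 0 := by
      by_contra hc
      push Not at hc
      exact absurd h (not_le.2 (mul_pos hpos hc))
    exact Subtype.ext (norm_le_zero_iff.1 h2)
  set e := LinearEquiv.ofBijective N ⟨hinj, hsurj⟩ with he
  have heN : ∀ f, N (e.symm f) = f := fun f => e.apply_symm_apply f
  refine ⟨LinearMap.mkContinuous (L.domain.subtype ∘ₗ e.symm.toLinearMap) (lam - ω)⁻¹ ?_,
    LinearMap.mkContinuous_norm_le _ (inv_nonneg.2 hpos.le) _, fun f => ⟨e.symm f, rfl, heN f⟩,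
    fun u => ?_⟩
  · intro f
    have h := hdiss (e.symm f)
    rw [← hNa, heN] at h
    rw [inv_mul_eq_div, le_div_iff₀ hpos, mul_comm]
    exact h
  · exact congrArg Subtype.val (e.symm_apply_apply u)

theorem resolvent_commute (L : X →ₗ.[ℝ] X) {lam mu : ℝ} {R S : X →L[ℝ] X}
    (hR : ∀ f, ∃ u : L.domain, R f = u ∧ lam • (u : X) - L u = f)
    (hR' : ∀ u : L.domain, R (lam • (u : X) - L u) = u)
    (hS : ∀ f, ∃ u : L.domain, S f = u ∧ mu • (u : X) - L u = f)
    (hS' : ∀ u : L.domain, S (mu • (u : X) - L u) = u) : Commute R S := by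
  have h1 : ∀ x, R x - S x = (mu - lam) • R (S x) := by
    intro x
    obtain ⟨a, ha, ha'⟩ := hR x
    obtain ⟨b, hb, hb'⟩ := hS x
    have := hR' (a - b)
    rw [LinearPMap.map_sub] at this
    have e : lam • ((a - b : L.domain) : X) - (L a - L b) = (mu - lam) • (b : X) := by
      rw [Submodule.coe_sub]
      have : lam • (a : X) - L a = mu • (b : X) - L b := ha'.trans hb'.symm
      rw [sub_smul, smul_sub, sub_sub_sub_comm, this]
      abel
    rw [e, map_smul, ← hb, Submodule.coe_sub, ← ha, ← hb] at this
    exact this.symm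
  have h2 : ∀ x, S x - R x = (lam - mu) • S (R x) := by
    intro x
    obtain ⟨a, ha, ha'⟩ := hS x
    obtain ⟨b, hb, hb'⟩ := hR x
    have := hS' (a - b)
    rw [LinearPMap.map_sub] at this
    have e : mu • ((a - b : L.domain) : X) - (L a - L b) = (lam - mu) • (b : X) := by
      rw [Submodule.coe_sub]
      have : mu • (a : X) - L a = lam • (b : X) - L b := ha'.trans hb'.symm
      rw [sub_smul, smul_sub, sub_sub_sub_comm, this]
      abel
    rw [e, map_smul, ← hb, Submodule.coe_sub, ← ha, ← hb] at this
    exact this.symm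
  rcases eq_or_ne lam mu with h | h
  · have : R = S := by
      ext x
      have := h1 x
      rwa [h, sub_self, zero_smul, sub_eq_zero] at this
    rw [this]
  · ext x
    have h3 : (mu - lam) • (R (S x) - S (R x)) = 0 := by
      rw [smul_sub, ← h1, ← neg_sub lam mu, neg_smul, ← h2]
      abel
    exact sub_eq_zero.1 ((smul_eq_zero.1 h3).resolve_left (sub_ne_zero.2 h.symm))

theorem IsDominatedSublinear.continuous {p : X → ℝ} (hp : IsDominatedSublinear p) :
    Continuous p := by
  have h : ∀ u v, p u - p v ≤ ‖u - v‖ := by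
    intro u v
    have := hp.add_le v (u - v)
    rw [add_sub_cancel] at this
    linarith [hp.le_norm (u - v)]
  refine LipschitzWith.continuous (K := 1) (LipschitzWith.of_dist_le_mul fun u v => ?_)
  rw [Real.dist_eq, dist_eq_norm, NNReal.coe_one, one_mul, abs_le]
  have := h v u
  rw [norm_sub_rev] at this
  constructor <;> linarith [h u v]

/-- The exponential of an operator that preserves the closed convex cone `{p ≤ 0}` preserves it. -/
theorem IsDominatedSublinear.exp_nonpos [CompleteSpace X] {p : X → ℝ} (hp : IsDominatedSublinear p)
    {R : X →L[ℝ] X} (hR : ∀ u, p u ≤ 0 → p (R u) ≤ 0) {u : X} (hu : p u ≤ 0) :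
    p (NormedSpace.exp R u) ≤ 0 := by
  have h1 : HasSum (fun n : ℕ => ((n.factorial : ℝ)⁻¹ • R ^ n) u) (NormedSpace.exp R u) :=
    (NormedSpace.exp_series_hasSum_exp' (𝕂 := ℝ) R).mapL (ContinuousLinearMap.apply ℝ X u)
  have hc : IsClosed {v | p v ≤ 0} := isClosed_le hp.continuous continuous_const
  refine hc.mem_of_tendsto h1 (Eventually.of_forall fun s => ?_)
  have hn : ∀ n : ℕ, p ((R ^ n) u) ≤ 0 := by
    intro n
    induction n with
    | zero => simpa using hu
    | succ n ih =>
      rw [pow_succ']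
      exact hR _ ih
  have h0 : p 0 ≤ 0 := by
    have := hp.le_norm 0
    rwa [norm_zero] at this
  change p (∑ n ∈ s, ((n.factorial : ℝ)⁻¹ • R ^ n) u) ≤ 0
  induction s using Finset.induction_on with
  | empty => simpa using h0
  | insert n s hns ih =>
    rw [Finset.sum_insert hns]
    refine (hp.add_le _ _).trans (add_nonpos ?_ ih)
    change p ((n.factorial : ℝ)⁻¹ • (R ^ n) u) ≤ 0
    rw [hp.smul_eq _ _ (by positivity)]
    exact mul_nonpos_of_nonneg_of_nonpos (by positivity) (hn n)

/-- The exponential of the Yosida approximant `λ² R - λ` of an operator with resolvent `R`. -/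
theorem exp_smul_yosida [CompleteSpace X] (R : X →L[ℝ] X) (t lam : ℝ) :
    NormedSpace.exp (t • (lam ^ 2 • R - lam • (1 : X →L[ℝ] X)))
      = Real.exp (-(t * lam)) • NormedSpace.exp ((t * lam ^ 2) • R) := by
  let _ : NormedAlgebra ℚ (X →L[ℝ] X) := NormedAlgebra.restrictScalars ℚ ℝ _
  have e : t • (lam ^ 2 • R - lam • (1 : X →L[ℝ] X))
      = algebraMap ℝ (X →L[ℝ] X) (-(t * lam)) + (t * lam ^ 2) • R := by
    rw [Algebra.algebraMap_eq_smul_one]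
    module
  rw [e, NormedSpace.exp_add_of_commute (Algebra.commutes _ _), ← NormedSpace.algebraMap_exp_comm,
    Algebra.algebraMap_eq_smul_one, smul_mul_assoc, one_mul, Real.exp_eq_exp_ℝ]

/-- The Hille–Yosida theorem in the form of Lumer and Phillips. The semigroup preserves the cone
`{p ≤ 0}` for every dominated sublinear functional `p` with respect to which `L` is dissipative. -/
theorem exists_semigroup_of_dissipative [CompleteSpace X] (L : X →ₗ.[ℝ] X) {ω lam₀ : ℝ}
    (hω : 0 ≤ ω) (hD : Dense (L.domain : Set X))
    (hdiss : ∀ lam, 0 ≤ lam → ∀ u : L.domain, (lam - ω) * ‖(u : X)‖ ≤ ‖lam • (u : X) - L u‖)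
    (hsurj : ∀ lam, lam₀ ≤ lam → ∀ f, ∃ u : L.domain, lam • (u : X) - L u = f) :
    ∃ T : ℝ → X →L[ℝ] X, IsC0Semigroup T ∧ generator T = L ∧
      (∀ t, 0 ≤ t → ‖T t‖ ≤ Real.exp (2 * ω * t)) ∧
      ∀ p : X → ℝ, IsDominatedSublinear p →
        (∀ lam, 0 ≤ lam → ∀ u : L.domain, (lam - ω) * p u ≤ p (lam • (u : X) - L u)) →
        ∀ u, p u ≤ 0 → ∀ t, 0 ≤ t → p (T t u) ≤ 0 := by
  -- `λ ≥ 2ω` gives `λ² / (λ - ω) - λ ≤ 2ω`, the growth bound of the Yosida approximants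
  set c : ℝ := max lam₀ (2 * ω + 1) with hc
  set lam : ℕ → ℝ := fun n => c + n with hlam
  have hlam1 : ∀ n, lam₀ ≤ lam n := fun n =>
    (le_max_left _ _).trans (le_add_of_nonneg_right n.cast_nonneg)
  have hlam2 : ∀ n, 2 * ω + 1 ≤ lam n := fun n =>
    (le_max_right _ _).trans (le_add_of_nonneg_right n.cast_nonneg)
  have hpos : ∀ n, 0 < lam n - ω := fun n => by linarith [hlam2 n]
  have hlam0 : ∀ n, 0 ≤ lam n := fun n => by linarith [hlam2 n]
  have hres : ∀ n, ∃ R : X →L[ℝ] X, ‖R‖ ≤ (lam n - ω)⁻¹ ∧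
      (∀ f, ∃ u : L.domain, R f = u ∧ lam n • (u : X) - L u = f) ∧
      ∀ u : L.domain, R (lam n • (u : X) - L u) = u := fun n =>
    exists_resolvent L (sub_pos.1 (hpos n)) (hdiss _ (hlam0 n)) (hsurj _ (hlam1 n))
  choose R hRn hR hR' using hres
  set A : ℕ → X →L[ℝ] X := fun n => lam n ^ 2 • R n - lam n • (1 : X →L[ℝ] X) with hA
  have hcomm : ∀ m n, Commute (A m) (A n) := by
    intro m n
    have h := resolvent_commute L (hR m) (hR' m) (hR n) (hR' n)
    have h1 : Commute (lam m ^ 2 • R m) (A n) :=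
      ((h.smul_left _).smul_right _).sub_right (((Commute.one_right _).smul_right _))
    exact h1.sub_left ((Commute.one_left _).smul_left _)
  have hb : ∀ (n : ℕ) (t : ℝ), 0 ≤ t → ‖NormedSpace.exp (t • A n)‖ ≤ Real.exp (2 * ω * t) := by
    intro n t ht
    rw [hA, exp_smul_yosida, norm_smul, Real.norm_of_nonneg (Real.exp_pos _).le]
    have h1 : ‖(t * lam n ^ 2) • R n‖ ≤ (t * lam n ^ 2) * (lam n - ω)⁻¹ := by
      rw [norm_smul, Real.norm_of_nonneg (by positivity)]
      exact mul_le_mul_of_nonneg_left (hRn n) (by positivity)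
    refine (mul_le_mul_of_nonneg_left ((norm_exp_le_exp_norm _).trans (Real.exp_le_exp.2 h1))
      (Real.exp_pos _).le).trans ?_
    rw [← Real.exp_add, Real.exp_le_exp, ← div_eq_mul_inv]
    have h2 : t * lam n ^ 2 / (lam n - ω) ≤ 2 * ω * t + t * lam n := by
      rw [div_le_iff₀ (hpos n)]
      have : 0 ≤ t * (ω * (lam n - 2 * ω)) :=
        mul_nonneg ht (mul_nonneg hω (by linarith [hlam2 n]))
      linarith
    linarith
  have hinv : Tendsto (fun n => (lam n - ω)⁻¹) atTop (𝓝 0) := by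
    refine tendsto_inv_atTop_zero.comp ?_
    have : (fun n => lam n - ω) = fun n : ℕ => (c - ω) + (n : ℝ) := by
      ext n; simp only [hlam]; ring
    rw [this]
    exact tendsto_atTop_add_const_left _ _ tendsto_natCast_atTop_atTop
  have hJ : ∀ u : X, Tendsto (fun n => (lam n • R n) u) atTop (𝓝 u) := by
    refine tendsto_of_dense (B := ContinuousLinearMap.id ℝ X) (M := 2) ?_ hD ?_
    · refine Eventually.of_forall fun n => ?_
      rw [norm_smul, Real.norm_of_nonneg (hlam0 n)]
      refine (mul_le_mul_of_nonneg_left (hRn n) (hlam0 n)).trans ?_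
      rw [← div_eq_mul_inv, div_le_iff₀ (hpos n)]
      linarith [hlam2 n]
    · intro u hu
      have h0 : Tendsto (fun n => R n (L ⟨u, hu⟩)) atTop (𝓝 0) := by
        refine squeeze_zero_norm (fun n => (R n).le_of_opNorm_le (hRn n) _) ?_
        simpa using hinv.mul_const ‖L ⟨u, hu⟩‖
      have h1 := h0.const_add u
      rw [add_zero] at h1
      refine h1.congr fun n => ?_
      have := hR' n ⟨u, hu⟩
      rw [map_sub, map_smul, sub_eq_iff_eq_add] at this
      exact this.symm
  have hA' : ∀ u : L.domain, Tendsto (fun n => A n u) atTop (𝓝 (L u)) := by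
    intro u
    refine (hJ (L u)).congr fun n => ?_
    have := hR' n u
    rw [map_sub, map_smul, sub_eq_iff_eq_add] at this
    change lam n • R n (L u) = lam n ^ 2 • R n u - lam n • (u : X)
    rw [pow_two, mul_smul, this, smul_add]
    abel
  classical
  obtain ⟨T, hT, hTb, hTg, hTlim⟩ := exists_semigroup_of_tendsto A hcomm (by positivity : 0 ≤ 2 * ω)
    hb hD (fun u => if hu : u ∈ L.domain then L ⟨u, hu⟩ else 0) (fun u hu => by
      have hu' : u ∈ L.domain := hu
      simpa only [dif_pos hu'] using hA' ⟨u, hu⟩)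
  have hTg' : ∀ u : L.domain, IsGeneratorValue T u (L u) := fun u => by
    simpa only [dif_pos u.2] using hTg u u.2
  refine ⟨T, hT, ?_, hTb, ?_⟩
  -- `L` has no proper extension `generator T`, as `λ - L` is onto and `λ - generator T` injective
  · have hle : L ≤ generator T :=
      ⟨fun u hu => ⟨_, hTg' ⟨u, hu⟩⟩, fun u v huv => by
        have h1 := hTg' u
        have h2 := generator_spec T v
        rw [← huv] at h2
        exact tendsto_nhds_unique h1 h2⟩
    refine (LinearPMap.eq_of_le_of_domain_eq hle (le_antisymm hle.1 fun u hu => ?_)).symm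
    have hg := generator_spec T ⟨u, hu⟩
    set g := generator T ⟨u, hu⟩
    obtain ⟨w, hw⟩ := hsurj (lam 0) (hlam1 0) (lam 0 • u - g)
    have hz : IsGeneratorValue T (u - w) (g - L w) := by
      refine (Tendsto.sub hg (hTg' w)).congr fun h => ?_
      rw [← smul_sub, map_sub]
      congr 1
      abel
    have h1 := isDominatedSublinear_norm.dissipative (ω := 2 * ω) (lam := lam 0)
      (F := fun h => T h (u - w)) (by
        filter_upwards [self_mem_nhdsWithin] with h hh
        exact (T h).le_of_opNorm_le (hTb h (le_of_lt (mem_Ioi.1 hh))) _) hz (hlam0 0)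
    have h2 : lam 0 • (u - w) - (g - L w) = 0 := by
      have : lam 0 • u - g = lam 0 • (w : X) - L w := hw.symm
      rw [smul_sub, sub_sub_sub_comm, this, sub_self]
    rw [h2, norm_zero] at h1
    have h3 : ‖u - w‖ ≤ 0 := by
      have h4 := hlam2 0
      nlinarith [norm_nonneg (u - w)]
    have h5 : u = w := sub_eq_zero.1 (norm_le_zero_iff.1 h3)
    rw [h5]
    exact w.2
  · intro p hp hpd u hu t ht
    have hcl : IsClosed {v | p v ≤ 0} := isClosed_le hp.continuous continuous_const
    refine hcl.mem_of_tendsto (hTlim t ht u) (Eventually.of_forall fun n => ?_)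
    have hRp : ∀ v, p v ≤ 0 → p (R n v) ≤ 0 := by
      intro v hv
      obtain ⟨w, hw1, hw2⟩ := hR n v
      have := hpd (lam n) (hlam0 n) w
      rw [hw2, ← hw1] at this
      exact nonpos_of_mul_nonpos_right (this.trans hv) (hpos n)
    change p (NormedSpace.exp (t • A n) u) ≤ 0
    rw [hA, exp_smul_yosida]
    change p (Real.exp (-(t * lam n)) • NormedSpace.exp ((t * lam n ^ 2) • R n) u) ≤ 0
    rw [hp.smul_eq _ _ (Real.exp_pos _).le]
    refine mul_nonpos_of_nonneg_of_nonpos (Real.exp_pos _).le (hp.exp_nonpos (fun v hv => ?_) hu)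
    change p ((t * lam n ^ 2) • R n v) ≤ 0
    rw [hp.smul_eq _ _ (by positivity)]
    exact mul_nonpos_of_nonneg_of_nonpos (by positivity) (hRp v hv)

/-! ### Perturbation of a contraction semigroup -/

theorem laplace_add {G : ℝ → X →L[ℝ] X} (hG : IsC0Semigroup G) (hb : ∀ t, 0 ≤ t → ‖G t‖ ≤ 1)
    {lam : ℝ} (hlam : 0 < lam) (u v : X) :
    laplace G lam (u + v) = laplace G lam u + laplace G lam v := by
  simp only [laplace, map_add, smul_add]
  exact integral_add (hG.integrableOn_laplace hb hlam u) (hG.integrableOn_laplace hb hlam v)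

theorem laplace_smul (G : ℝ → X →L[ℝ] X) (lam c : ℝ) (u : X) :
    laplace G lam (c • u) = c • laplace G lam u := by
  simp only [laplace, map_smul]
  rw [← integral_smul]
  simp only [smul_comm c]

theorem eq_zero_of_isGeneratorValue_smul {G : ℝ → X →L[ℝ] X} (hb : ∀ t, 0 ≤ t → ‖G t‖ ≤ 1)
    {lam : ℝ} (hlam : 0 < lam) {z : X} (hz : IsGeneratorValue G z (lam • z)) : z = 0 := by
  have h1 := isDominatedSublinear_norm.dissipative (ω := 0) (lam := lam) (F := fun h => G h z) (by
    filter_upwards [self_mem_nhdsWithin] with h hh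
    rw [zero_mul, Real.exp_zero]
    exact (G h).le_of_opNorm_le (hb h (le_of_lt (mem_Ioi.1 hh))) _) hz hlam.le
  rw [sub_self, norm_zero, sub_zero] at h1
  exact norm_le_zero_iff.1 (nonpos_of_mul_nonpos_right h1 hlam)

/-- The Laplace transform is a left inverse of `λ - G`: by dissipativity, `λ - G` is injective. -/
theorem laplace_of_isGeneratorValue [CompleteSpace X] {G : ℝ → X →L[ℝ] X} (hG : IsC0Semigroup G)
    (hb : ∀ t, 0 ≤ t → ‖G t‖ ≤ 1) {lam : ℝ} (hlam : 0 < lam) {u g : X}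
    (hu : IsGeneratorValue G u g) : laplace G lam (lam • u - g) = u := by
  have h := hG.isGeneratorValue_laplace hb hlam (lam • u - g)
  rw [← sub_eq_zero]
  refine eq_zero_of_isGeneratorValue_smul hb hlam ?_
  have e : lam • (laplace G lam (lam • u - g) - u)
      = (lam • laplace G lam (lam • u - g) - (lam • u - g)) - g := by
    rw [smul_sub]; abel
  rw [e]
  refine (Tendsto.sub h hu).congr fun h => ?_
  rw [← smul_sub, map_sub]
  congr 1
  abel

/-- The weight `e^{-λt} c (1 + t^{-1/2})`, the integrand in the bound for `B (λ - A)⁻¹`. -/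
def laplaceWeight (c lam t : ℝ) : ℝ := Real.exp (-lam * t) * (c * (1 + t ^ (-(1 / 2) : ℝ)))

theorem laplaceWeight_integrable_integral (c : ℝ) {lam : ℝ} (hlam : 0 < lam) :
    IntegrableOn (laplaceWeight c lam) (Ioi 0) ∧
    ∫ t in Ioi (0 : ℝ), laplaceWeight c lam t
      = c * (lam⁻¹ + (lam⁻¹) ^ (1 / 2 : ℝ) * Real.Gamma (1 / 2)) := by
  have h1 := Real.integral_rpow_mul_exp_neg_mul_Ioi (a := 1) one_pos hlam
  have h2 := Real.integral_rpow_mul_exp_neg_mul_Ioi (a := 1 / 2) (by norm_num) hlam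
  have i1 : IntegrableOn (fun t : ℝ => t ^ (1 - 1 : ℝ) * Real.exp (-(lam * t))) (Ioi 0) := by
    refine not_imp_comm.1 integral_undef (h1.trans_ne ?_)
    exact (mul_pos (Real.rpow_pos_of_pos (by positivity) _) (Real.Gamma_pos_of_pos one_pos)).ne'
  have i2 : IntegrableOn (fun t : ℝ => t ^ (1 / 2 - 1 : ℝ) * Real.exp (-(lam * t))) (Ioi 0) := by
    refine not_imp_comm.1 integral_undef (h2.trans_ne ?_)
    exact (mul_pos (Real.rpow_pos_of_pos (by positivity) _)
      (Real.Gamma_pos_of_pos (by norm_num))).ne'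
  have e : laplaceWeight c lam = fun t : ℝ => c * (t ^ (1 - 1 : ℝ) * Real.exp (-(lam * t))
      + t ^ (1 / 2 - 1 : ℝ) * Real.exp (-(lam * t))) := by
    ext t
    rw [laplaceWeight, show (1 / 2 - 1 : ℝ) = -(1 / 2) by norm_num, sub_self, Real.rpow_zero,
      neg_mul]
    ring
  rw [e]
  refine ⟨(i1.add i2).const_mul c, ?_⟩
  rw [integral_const_mul, integral_add i1 i2, h1, h2]
  simp

theorem exists_laplaceWeight_lt_one (c : ℝ) :
    ∃ lam₀ : ℝ, 1 ≤ lam₀ ∧ ∀ lam, lam₀ ≤ lam →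
      ∫ t in Ioi (0 : ℝ), laplaceWeight c lam t < 1 := by
  have h : Tendsto (fun lam : ℝ => c * (lam⁻¹ + (lam⁻¹) ^ (1 / 2 : ℝ) * Real.Gamma (1 / 2))) atTop
      (𝓝 (c * (0 + 0 ^ (1 / 2 : ℝ) * Real.Gamma (1 / 2)))) :=
    (tendsto_inv_atTop_zero.add ((tendsto_inv_atTop_zero.rpow_const
      (Or.inr (by norm_num))).mul_const _)).const_mul c
  rw [Real.zero_rpow (by norm_num)] at h
  simp only [zero_mul, add_zero, mul_zero] at h
  obtain ⟨a, ha⟩ := eventually_atTop.1 (h.eventually_lt_const one_pos)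
  refine ⟨max a 1, le_max_right _ _, fun lam hl => ?_⟩
  rw [(laplaceWeight_integrable_integral c
    (one_pos.trans_le ((le_max_right a 1).trans hl))).2]
  exact ha lam ((le_max_left _ _).trans hl)

/-- If `S` is differentiable at `0` on the range of each `G t`, `t > 0`, with difference quotients of
size `O(1 + t^{-1/2})`, then the range of the resolvent of the generator of `G` lies in the domain
of the generator `B` of `S`, and `‖B (λ - A)⁻¹‖ ≤ ∫₀^∞ e^{-λt} c (1 + t^{-1/2}) dt`. -/
theorem exists_isGeneratorValue_laplace [CompleteSpace X] {G S : ℝ → X →L[ℝ] X}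
    (hG : IsC0Semigroup G) (hGb : ∀ t, 0 ≤ t → ‖G t‖ ≤ 1) {c : ℝ}
    (hgen : ∀ t, 0 < t → ∀ u, ∃ f, IsGeneratorValue S (G t u) f)
    (hbd : ∀ t, 0 < t → ∀ h, 0 < h → h ≤ 1 → ∀ u,
      ‖S h (G t u) - G t u‖ ≤ h * (c * (1 + t ^ (-(1 / 2) : ℝ))) * ‖u‖)
    {lam : ℝ} (hlam : 0 < lam) (u : X) :
    ∃ f, IsGeneratorValue S (laplace G lam u) f ∧
      ‖f‖ ≤ (∫ t in Ioi (0 : ℝ), laplaceWeight c lam t) * ‖u‖ := by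
  have hgen' : ∀ t, ∃ f, 0 < t → IsGeneratorValue S (G t u) f := fun t => by
    by_cases ht : 0 < t
    · obtain ⟨f, hf⟩ := hgen t ht u
      exact ⟨f, fun _ => hf⟩
    · exact ⟨0, fun h => absurd h ht⟩
  choose k hk using hgen'
  have hi := hG.integrableOn_laplace hGb hlam u
  have hw := (laplaceWeight_integrable_integral c hlam).1
  have hquot : ∀ t, 0 < t → ∀ h, 0 < h → h ≤ 1 →
      ‖Real.exp (-lam * t) • h⁻¹ • (S h (G t u) - G t u)‖ ≤ laplaceWeight c lam t * ‖u‖ := by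
    intro t ht h hh hh1
    rw [norm_smul, norm_smul, Real.norm_of_nonneg (Real.exp_pos _).le,
      Real.norm_of_nonneg (inv_nonneg.2 hh.le), laplaceWeight, mul_assoc]
    refine mul_le_mul_of_nonneg_left ?_ (Real.exp_pos _).le
    rw [inv_mul_le_iff₀ hh, ← mul_assoc]
    exact hbd t ht h hh hh1 u
  have hev : ∀ᶠ h : ℝ in 𝓝[>] 0, 0 < h ∧ h ≤ 1 := by
    filter_upwards [Ioo_mem_nhdsGT (zero_lt_one' ℝ)] with h hh using ⟨hh.1, hh.2.le⟩
  have hfi : ∀ h, IntegrableOn (fun t => Real.exp (-lam * t) • h⁻¹ • (S h (G t u) - G t u))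
      (Ioi 0) := by
    intro h
    have h1 := (((S h).integrable_comp hi).sub hi).smul h⁻¹
    refine h1.congr (Eventually.of_forall fun t => ?_)
    simp only [Pi.smul_apply, Pi.sub_apply, map_smul, ← smul_sub]
    rw [smul_comm]
  refine ⟨∫ t in Ioi (0 : ℝ), Real.exp (-lam * t) • k t, ?_, ?_⟩
  · have hdct : Tendsto (fun h : ℝ => ∫ t in Ioi (0 : ℝ), Real.exp (-lam * t) •
        h⁻¹ • (S h (G t u) - G t u)) (𝓝[>] 0) (𝓝 (∫ t in Ioi (0 : ℝ), Real.exp (-lam * t) • k t)) := by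
      refine tendsto_integral_filter_of_dominated_convergence
        (fun t => laplaceWeight c lam t * ‖u‖)
        (Eventually.of_forall fun h => (hfi h).aestronglyMeasurable) ?_ (hw.mul_const _) ?_
      · filter_upwards [hev] with h hh
        filter_upwards [ae_restrict_mem measurableSet_Ioi] with t ht
        exact hquot t ht h hh.1 hh.2
      · filter_upwards [ae_restrict_mem measurableSet_Ioi] with t ht
        exact (hk t ht).const_smul _
    refine hdct.congr fun h => ?_
    rw [laplace, ← ContinuousLinearMap.integral_comp_comm _ hi,
      ← integral_sub ((S h).integrable_comp hi) hi, ← integral_smul]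
    refine integral_congr_ae (Eventually.of_forall fun t => ?_)
    simp only [map_smul, ← smul_sub]
    rw [smul_comm]
  · rw [← integral_mul_const]
    refine norm_integral_le_of_norm_le (hw.mul_const _) ?_
    filter_upwards [ae_restrict_mem measurableSet_Ioi] with t ht
    refine le_of_tendsto ((hk t ht).const_smul (Real.exp (-lam * t))).norm ?_
    filter_upwards [hev] with h hh
    exact hquot t ht h hh.1 hh.2

/-- Perturbation of the generator of a contraction semigroup `G` by the generator of a family `S`
that is relatively small along `G`. -/
theorem exists_semigroup_add [CompleteSpace X] {G S : ℝ → X →L[ℝ] X}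
    (hG : IsC0Semigroup G) (hGb : ∀ t, 0 ≤ t → ‖G t‖ ≤ 1) {ω c : ℝ} (hω : 0 ≤ ω)
    (hSb : ∀ h, 0 < h → h ≤ 1 → ‖S h‖ ≤ Real.exp (ω * h))
    (hgen : ∀ t, 0 < t → ∀ u, ∃ f, IsGeneratorValue S (G t u) f)
    (hbd : ∀ t, 0 < t → ∀ h, 0 < h → h ≤ 1 → ∀ u,
      ‖S h (G t u) - G t u‖ ≤ h * (c * (1 + t ^ (-(1 / 2) : ℝ))) * ‖u‖) :
    (generator G).domain ≤ (generator S).domain ∧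
    ∃ T : ℝ → X →L[ℝ] X, IsC0Semigroup T ∧ generator T = generator G + generator S ∧
      (∀ t, 0 ≤ t → ‖T t‖ ≤ Real.exp (2 * ω * t)) ∧
      ∀ p : X → ℝ, IsDominatedSublinear p →
        (∀ h, 0 < h → h ≤ 1 → ∀ u, p (G h (S h u)) ≤ Real.exp (ω * h) * p u) →
        ∀ u, p u ≤ 0 → ∀ t, 0 ≤ t → p (T t u) ≤ 0 := by
  have hle : (generator G).domain ≤ (generator S).domain := by
    rintro u ⟨g, hg⟩
    obtain ⟨f, hf, -⟩ := exists_isGeneratorValue_laplace hG hGb hgen hbd one_pos ((1 : ℝ) • u - g)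
    rw [laplace_of_isGeneratorValue hG hGb one_pos hg] at hf
    exact ⟨f, hf⟩
  refine ⟨hle, ?_⟩
  have hdom : (generator G + generator S).domain = (generator G).domain := inf_eq_left.2 hle
  have hval : ∀ u : (generator G + generator S).domain, ∃ a b,
      IsGeneratorValue G (u : X) a ∧ IsGeneratorValue S (u : X) b ∧
      (generator G + generator S) u = a + b := fun u =>
    ⟨_, _, generator_spec G ⟨u, u.2.1⟩, generator_spec S ⟨u, u.2.2⟩, LinearPMap.add_apply _ _ _⟩
  have hev : ∀ᶠ h : ℝ in 𝓝[>] 0, 0 < h ∧ h ≤ 1 := by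
    filter_upwards [Ioo_mem_nhdsGT (zero_lt_one' ℝ)] with h hh using ⟨hh.1, hh.2.le⟩
  have hdiss : ∀ p : X → ℝ, IsDominatedSublinear p →
        (∀ h, 0 < h → h ≤ 1 → ∀ u, p (G h (S h u)) ≤ Real.exp (ω * h) * p u) →
        ∀ lam, 0 ≤ lam → ∀ u : (generator G + generator S).domain,
          (lam - ω) * p u ≤ p (lam • (u : X) - (generator G + generator S) u) := by
    intro p hp hpb lam hlam u
    obtain ⟨a, b, ha, hb, hab⟩ := hval u
    rw [hab]
    refine hp.dissipative (F := fun h => G h (S h u)) ?_ ?_ hlam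
    · filter_upwards [hev] with h hh using hpb h hh.1 hh.2 u
    -- `G h (S h u) - u = G h (S h u - u) + (G h u - u)`
    · have h1 : Tendsto (fun h : ℝ => G h (h⁻¹ • (S h u - u))) (𝓝[>] 0) (𝓝 b) := by
        have h2 : Tendsto (fun h : ℝ => G h (h⁻¹ • (S h u - u) - b)) (𝓝[>] 0) (𝓝 0) := by
          refine squeeze_zero_norm' (a := fun h : ℝ => ‖h⁻¹ • (S h u - u) - b‖) ?_
            (tendsto_iff_norm_sub_tendsto_zero.1 hb)
          filter_upwards [hev] with h hh
          simpa using (G h).le_of_opNorm_le (hGb h hh.1.le) (h⁻¹ • (S h (u : X) - u) - b)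
        simpa using h2.add (hG.tendsto_zero b)
      refine (Tendsto.add ha h1).congr fun h => ?_
      rw [map_smul, ← smul_add, map_sub]
      congr 1
      abel
  obtain ⟨lam₀, hlam₀, hlt⟩ := exists_laplaceWeight_lt_one c
  have hsurj : ∀ lam, lam₀ ≤ lam → ∀ f, ∃ u : (generator G + generator S).domain,
      lam • (u : X) - (generator G + generator S) u = f := by
    intro lam hl f
    have hpos : 0 < lam := by linarith
    choose q hq hqn using exists_isGeneratorValue_laplace hG hGb hgen hbd hpos
    -- `Q = B (λ - A)⁻¹`; then `λ - A - B = (1 - Q) (λ - A)` on `D(A)`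
    set Q : X →L[ℝ] X := LinearMap.mkContinuous
      { toFun := q
        map_add' := fun x y => by
          refine tendsto_nhds_unique (hq (x + y)) ((Tendsto.add (hq x) (hq y)).congr fun h => ?_)
          rw [laplace_add hG hGb hpos, ← smul_add, map_add]
          congr 1
          abel
        map_smul' := fun r x => by
          refine tendsto_nhds_unique (hq (r • x)) ((Tendsto.const_smul (hq x) r).congr fun h => ?_)
          rw [laplace_smul, map_smul, ← smul_sub, smul_comm] }
      (∫ t in Ioi (0 : ℝ), laplaceWeight c lam t) hqn with hQ
    have hQn : ‖Q‖ < 1 := by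
      refine lt_of_le_of_lt (LinearMap.mkContinuous_norm_le' _ _) (max_lt (hlt lam hl) one_pos)
    obtain ⟨U, hU⟩ := isUnit_one_sub_of_norm_lt_one hQn
    set g := (↑U⁻¹ : X →L[ℝ] X) f with hg
    have hgf : g - q g = f := by
      have h1 : (↑U : X →L[ℝ] X) g = f := by
        rw [hg, ← mul_apply_eq_comp, Units.mul_inv]
        rfl
      rw [hU] at h1
      exact h1
    have hA := hG.isGeneratorValue_laplace hGb hpos g
    have hB := hq g
    refine ⟨⟨laplace G lam g, ⟨_, hA⟩, ⟨_, hB⟩⟩, ?_⟩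
    rw [LinearPMap.add_apply]
    have e1 : generator G ⟨laplace G lam g, _⟩ = _ := generator_eq hA ⟨_, hA⟩
    have e2 : generator S ⟨laplace G lam g, _⟩ = _ := generator_eq hB ⟨_, hB⟩
    rw [e1, e2, ← hgf]
    abel
  have hd : Dense ((generator G + generator S).domain : Set X) := by
    rw [hdom]
    exact hG.dense_domain
  obtain ⟨T, hT, hTg, hTb, hTp⟩ := exists_semigroup_of_dissipative _ hω hd
    (hdiss _ isDominatedSublinear_norm fun h hh hh1 u => by
      have h1 := (G h).le_of_opNorm_le (hGb h hh.le) (S h u)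
      rw [one_mul] at h1
      exact h1.trans ((S h).le_of_opNorm_le (hSb h hh hh1) u)) hsurj
  exact ⟨T, hT, hTg, hTb, fun p hp hpb => hTp p hp (hdiss p hp hpb)⟩

end Abstract

/-! ### `L¹`-valued integrals and translations -/

theorem L1.integrable_coeFn (u : L1) : Integrable u volume := MeasureTheory.L1.integrable_coeFn u

theorem L1.norm_eq_integral (u : L1) : ‖u‖ = ∫ x, ‖u x‖ := MeasureTheory.L1.norm_eq_integral_norm u

/-- Integration over a set, as a bounded functional on `L¹(ℝ²)`. -/
def setIntegralCLM (s : Set Plane) : L1 →L[ℝ] ℝ :=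
  LinearMap.mkContinuous
    { toFun := fun u => ∫ x in s, u x
      map_add' := fun u v => by
        rw [← integral_add (L1.integrable_coeFn u).integrableOn (L1.integrable_coeFn v).integrableOn]
        exact integral_congr_ae (ae_restrict_of_ae (Lp.coeFn_add u v))
      map_smul' := fun c u => by
        rw [RingHom.id_apply, ← integral_smul]
        exact integral_congr_ae (ae_restrict_of_ae (Lp.coeFn_smul c u)) } 1
    (fun u => by
      rw [one_mul, L1.norm_eq_integral]
      exact (norm_integral_le_integral_norm _).trans
        (setIntegral_le_integral (L1.integrable_coeFn u).norm
          (Eventually.of_forall fun x => norm_nonneg _)))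

/-- An `L¹`-valued Bochner integral is, almost everywhere, the pointwise integral of jointly
measurable representatives. -/
theorem coeFn_integral_L1 {α : Type*} [MeasurableSpace α] {μ : Measure α} [SigmaFinite μ]
    {f : α → L1} (hf : Integrable f μ) {F : α → Plane → ℝ}
    (hF : AEStronglyMeasurable (Function.uncurry F) (μ.prod volume))
    (hfF : ∀ᵐ a ∂μ, f a =ᵐ[volume] F a) :
    (∫ a, f a ∂μ : L1) =ᵐ[volume] fun x => ∫ a, F a x ∂μ := by
  have hFi : Integrable (Function.uncurry F) (μ.prod volume) := by
    refine (integrable_prod_iff hF).2 ⟨?_, ?_⟩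
    · filter_upwards [hfF] with a ha
      exact (L1.integrable_coeFn (f a)).congr ha
    · refine hf.norm.congr ?_
      filter_upwards [hfF] with a ha
      rw [L1.norm_eq_integral]
      exact integral_congr_ae (ha.mono fun x hx => by simp only [hx, Function.uncurry_apply_pair])
  refine Integrable.ae_eq_of_forall_setIntegral_eq _ _ (L1.integrable_coeFn _)
    hFi.integral_prod_right fun s hs _ => ?_
  have h1 : ∫ x in s, (∫ a, f a ∂μ : L1) x = ∫ a, (∫ x in s, f a x) ∂μ :=
    ((setIntegralCLM s).integral_comp_comm hf).symm
  have h2 : Integrable (Function.uncurry F) (μ.prod (volume.restrict s)) := by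
    have := hFi.restrict (s := univ ×ˢ s)
    rwa [← Measure.prod_restrict, Measure.restrict_univ] at this
  rw [h1, ← integral_integral_swap h2]
  refine integral_congr_ae ?_
  filter_upwards [hfF] with a ha
  exact integral_congr_ae (ae_restrict_of_ae ha)

/-- Translation by `z`, the isometry `u ↦ u (· - z)` of `L¹(ℝ²)`. -/
def translate (z : Plane) : L1 →L[ℝ] L1 :=
  (Lp.compMeasurePreservingₗᵢ ℝ (fun x => x - z)
    (measurePreserving_sub_right volume z)).toContinuousLinearMap

theorem coeFn_translate (z : Plane) (u : L1) : translate z u =ᵐ[volume] fun x => u (x - z) :=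
  Lp.coeFn_compMeasurePreserving u (measurePreserving_sub_right volume z)

theorem norm_translate (z : Plane) (u : L1) : ‖translate z u‖ = ‖u‖ :=
  Lp.norm_compMeasurePreserving u (measurePreserving_sub_right volume z)

theorem continuous_translate (u : L1) : Continuous fun z => translate z u := by
  let g : C(Plane, C(Plane, Plane)) := (ContinuousMap.mk (fun p : Plane × Plane => p.2 - p.1)).curry
  exact Continuous.compMeasurePreservingLp (f := fun _ => u) continuous_const g.continuous
    (fun z => measurePreserving_sub_right volume z) (by simp)

/-! ### Gaussian kernels -/

/-- The Gaussian probability density `(π a)⁻¹ exp (-|x|² / a)` of width `√a`; the heat kernel at time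
`t` is the case `a = 4 ε² t`. -/
def gauss (a : ℝ) (x : Plane) : ℝ := (Real.pi * a)⁻¹ * Real.exp (-‖x‖ ^ 2 / a)

theorem heatKernel_eq_gauss (ε t : ℝ) (x : Plane) : heatKernel ε t x = gauss (4 * ε ^ 2 * t) x := by
  rw [heatKernel, gauss, one_div]
  congr 2
  ring

theorem gauss_pos {a : ℝ} (ha : 0 < a) (x : Plane) : 0 < gauss a x := by
  rw [gauss]; positivity

theorem continuous_gauss (a : ℝ) : Continuous (gauss a) := by
  unfold gauss; fun_prop

theorem integral_exp_neg_norm_sq_div {a : ℝ} (ha : 0 < a) :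
    ∫ x : Plane, Real.exp (-‖x‖ ^ 2 / a) = Real.pi * a := by
  have := GaussianFourier.integral_rexp_neg_mul_sq_norm (V := Plane) (inv_pos.2 ha)
  rw [finrank_euclideanSpace_fin] at this
  simp only [Nat.cast_ofNat, div_self (two_ne_zero : (2 : ℝ) ≠ 0), Real.rpow_one, div_inv_eq_mul]
    at this
  rw [← this]
  congr 1
  ext x
  congr 1
  ring

theorem integral_gauss {a : ℝ} (ha : 0 < a) : ∫ x, gauss a x = 1 := by
  simp only [gauss]
  rw [integral_const_mul, integral_exp_neg_norm_sq_div ha]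
  exact inv_mul_cancel₀ (by positivity)

theorem integrable_gauss {a : ℝ} (ha : 0 < a) : Integrable (gauss a) volume :=
  .of_integral_ne_zero (by rw [integral_gauss ha]; exact one_ne_zero)

theorem integrable_gauss_sub {a : ℝ} (ha : 0 < a) (z : Plane) :
    Integrable (fun x => gauss a (x - z)) volume := (integrable_gauss ha).comp_sub_right z

theorem gauss_smul {a r : ℝ} (hr : 0 < r) (x : Plane) :
    gauss (a * r ^ 2) (r • x) = (r ^ 2)⁻¹ * gauss a x := by
  have e : -(r * ‖x‖) ^ 2 / (a * r ^ 2) = -‖x‖ ^ 2 / a := by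
    rw [mul_pow, mul_comm a, ← mul_neg, mul_div_mul_left _ _ (by positivity)]
  rw [gauss, gauss, norm_smul, Real.norm_of_nonneg hr.le, e, ← mul_assoc, mul_inv, mul_inv]
  ring

/-- Completing the square in `y`. -/
theorem norm_sub_sq_div_add {a b : ℝ} (ha : 0 < a) (hb : 0 < b) (x y : Plane) :
    ‖x - y‖ ^ 2 / a + ‖y‖ ^ 2 / b
      = ‖y - (b / (a + b)) • x‖ ^ 2 / (a * b / (a + b)) + ‖x‖ ^ 2 / (a + b) := by
  rw [norm_sub_sq_real, norm_sub_sq_real, inner_smul_right, norm_smul, mul_pow, Real.norm_eq_abs,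
    sq_abs, real_inner_comm]
  have : a + b ≠ 0 := by positivity
  field_simp
  ring

/-- The convolution of two Gaussians is a Gaussian. -/
theorem integral_gauss_mul_gauss {a b : ℝ} (ha : 0 < a) (hb : 0 < b) (x z : Plane) :
    ∫ y, gauss a (x - y) * gauss b (y - z) = gauss (a + b) (x - z) := by
  have h1 : ∫ y, gauss a (x - y) * gauss b (y - z) = ∫ y, gauss a ((x - z) - y) * gauss b y := by
    rw [← integral_sub_right_eq_self (fun y => gauss a ((x - z) - y) * gauss b y) z]
    simp only [sub_sub_sub_cancel_right]
  rw [h1]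
  generalize x - z = w
  have hab : 0 < a * b / (a + b) := by positivity
  have h2 : ∀ y, gauss a (w - y) * gauss b y = gauss (a + b) w *
      gauss (a * b / (a + b)) (y - (b / (a + b)) • w) := by
    intro y
    have e := norm_sub_sq_div_add ha hb w y
    have e2 : -‖w - y‖ ^ 2 / a + -‖y‖ ^ 2 / b = -‖w‖ ^ 2 / (a + b)
        + -‖y - (b / (a + b)) • w‖ ^ 2 / (a * b / (a + b)) := by
      rw [neg_div, neg_div, neg_div, neg_div]
      linarith
    simp only [gauss]
    have hne : a + b ≠ 0 := by positivity
    have hc : (Real.pi * a)⁻¹ * (Real.pi * b)⁻¹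
        = (Real.pi * (a + b))⁻¹ * (Real.pi * (a * b / (a + b)))⁻¹ := by
      field_simp
    rw [mul_mul_mul_comm, ← Real.exp_add, e2, Real.exp_add, hc, mul_mul_mul_comm]
  simp only [h2]
  rw [integral_const_mul, integral_sub_right_eq_self (gauss (a * b / (a + b))),
    integral_gauss hab, mul_one]

/-- The translated Gaussian `x ↦ gauss a (x - z)` as an element of `L¹`; it is set to `0` when
`a ≤ 0`. -/
def gaussL1 (a : ℝ) (z : Plane) : L1 :=
  if ha : 0 < a then (integrable_gauss_sub ha z).toL1 _ else 0

theorem coeFn_gaussL1 {a : ℝ} (ha : 0 < a) (z : Plane) :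
    gaussL1 a z =ᵐ[volume] fun x => gauss a (x - z) := by
  rw [gaussL1, dif_pos ha]
  exact Integrable.coeFn_toL1 _

theorem norm_gaussL1 {a : ℝ} (ha : 0 < a) (z : Plane) : ‖gaussL1 a z‖ = 1 := by
  rw [L1.norm_eq_integral, ← integral_gauss ha, ← integral_sub_right_eq_self (gauss a) z]
  refine integral_congr_ae ((coeFn_gaussL1 ha z).mono fun x hx => ?_)
  simp only [hx, Real.norm_of_nonneg (gauss_pos ha _).le]

theorem continuous_gaussL1 {a : ℝ} (ha : 0 < a) : Continuous (gaussL1 a) := by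
  have : gaussL1 a = fun z => translate z (gaussL1 a 0) := by
    ext1 z
    refine Lp.ext ?_
    have h1 := (measurePreserving_sub_right volume z).quasiMeasurePreserving.ae_eq_comp
      (coeFn_gaussL1 ha 0)
    filter_upwards [coeFn_gaussL1 ha z, coeFn_translate z (gaussL1 a 0), h1] with x h1 h2 h3
    rw [h1, h2]
    simp only [Function.comp_apply, sub_zero] at h3
    exact h3.symm
  rw [this]
  exact continuous_translate _

theorem integrable_smul_gaussL1 {a : ℝ} (ha : 0 < a) (u : L1) :
    Integrable (fun z => u z • gaussL1 a z) volume := by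
  refine (L1.integrable_coeFn u).smul_of_top_left ?_
  exact memLp_top_of_bound (continuous_gaussL1 ha).aestronglyMeasurable 1
    (Eventually.of_forall fun z => (norm_gaussL1 ha z).le)

/-! ### The heat semigroup -/

theorem integrable_gauss_smul_translate {a : ℝ} (ha : 0 < a) (r : ℝ) (u : L1) :
    Integrable (fun y => gauss a y • translate (r • y) u) volume := by
  refine (integrable_gauss ha).smul_of_top_left ?_
  refine memLp_top_of_bound (((continuous_translate u).comp
    (continuous_const_smul r)).aestronglyMeasurable) ‖u‖
    (Eventually.of_forall fun z => (norm_translate _ u).le)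

/-- The average of the translates `u (· - r y)` of `u` against the Gaussian density in `y`; it is set
to `0` when `a ≤ 0`. For `r = √t` and `a = 4 ε²` it is the heat semigroup at time `t`, in a form that
is continuous in `t` down to `t = 0`. -/
def heatAverage (a r : ℝ) : L1 →L[ℝ] L1 :=
  if ha : 0 < a then
    LinearMap.mkContinuous
      { toFun := fun u => ∫ y, gauss a y • translate (r • y) u
        map_add' := fun u v => by
          simp only [map_add, smul_add]
          exact integral_add (integrable_gauss_smul_translate ha r u)
            (integrable_gauss_smul_translate ha r v)
        map_smul' := fun c u => by
          simp only [map_smul, RingHom.id_apply]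
          rw [← integral_smul]
          simp only [smul_comm c] } 1
      (fun u => by
        rw [one_mul, ← one_mul ‖u‖, ← integral_gauss ha, ← integral_mul_const]
        refine norm_integral_le_of_norm_le ((integrable_gauss ha).mul_const _)
          (Eventually.of_forall fun y => ?_)
        rw [norm_smul, norm_translate, Real.norm_of_nonneg (gauss_pos ha y).le])
  else 0

theorem heatAverage_apply {a : ℝ} (ha : 0 < a) (r : ℝ) (u : L1) :
    heatAverage a r u = ∫ y, gauss a y • translate (r • y) u := by
  rw [heatAverage, dif_pos ha]
  rfl

theorem norm_heatAverage_le {a : ℝ} (ha : 0 < a) (r : ℝ) : ‖heatAverage a r‖ ≤ 1 := by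
  rw [heatAverage, dif_pos ha]
  exact LinearMap.mkContinuous_norm_le _ zero_le_one _

theorem heatAverage_zero {a : ℝ} (ha : 0 < a) (u : L1) : heatAverage a 0 u = u := by
  have h0 : translate 0 u = u := by
    refine Lp.ext ?_
    filter_upwards [coeFn_translate 0 u] with x hx
    rw [hx, sub_zero]
  rw [heatAverage_apply ha]
  simp only [zero_smul, h0]
  rw [integral_smul_const, integral_gauss ha, one_smul]

theorem coeFn_heatAverage {a r : ℝ} (ha : 0 < a) (hr : 0 < r) (u : L1) :
    heatAverage a r u =ᵐ[volume] fun x => ∫ z, gauss (a * r ^ 2) (x - z) * u z := by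
  rw [heatAverage_apply ha]
  have hm : StronglyMeasurable (u : Plane → ℝ) := Lp.stronglyMeasurable u
  refine (coeFn_integral_L1 (integrable_gauss_smul_translate ha r u)
    (F := fun y x => gauss a y * u (x - r • y)) ?_ ?_).trans (Eventually.of_forall fun x => ?_)
  · refine StronglyMeasurable.aestronglyMeasurable ?_
    refine ((continuous_gauss a).comp continuous_fst).stronglyMeasurable.mul ?_
    exact hm.comp_measurable (by fun_prop : Measurable fun p : Plane × Plane => p.2 - r • p.1)
  · refine Eventually.of_forall fun y => ?_
    filter_upwards [Lp.coeFn_smul (gauss a y) (translate (r • y) u), coeFn_translate (r • y) u]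
      with x h1 h2
    rw [h1, Pi.smul_apply, h2, smul_eq_mul]
  · have e1 : ∀ y, gauss a y * u (x - r • y)
        = r ^ 2 * (fun w => gauss (a * r ^ 2) w * u (x - w)) (r • y) := by
      intro y
      simp only
      rw [gauss_smul hr, ← mul_assoc, ← mul_assoc, mul_inv_cancel₀ (by positivity), one_mul]
    simp_rw [e1]
    rw [integral_const_mul, Measure.integral_comp_smul volume
      (fun w => gauss (a * r ^ 2) w * u (x - w)) r, finrank_euclideanSpace_fin,
      abs_of_pos (by positivity), smul_eq_mul, ← mul_assoc, mul_inv_cancel₀ (by positivity),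
      one_mul, ← integral_sub_left_eq_self _ volume x]
    simp only [sub_sub_cancel]

theorem coeFn_integral_smul_gaussL1 {a : ℝ} (ha : 0 < a) (u : L1) :
    (∫ z, u z • gaussL1 a z : L1) =ᵐ[volume] fun x => ∫ z, gauss a (x - z) * u z := by
  refine coeFn_integral_L1 (integrable_smul_gaussL1 ha u)
    (F := fun z x => gauss a (x - z) * u z) ?_ ?_
  · refine StronglyMeasurable.aestronglyMeasurable ?_
    exact ((continuous_gauss a).comp (continuous_snd.sub continuous_fst)).stronglyMeasurable.mul
      ((Lp.stronglyMeasurable u).comp_measurable measurable_fst)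
  · refine Eventually.of_forall fun z => ?_
    filter_upwards [Lp.coeFn_smul (u z) (gaussL1 a z), coeFn_gaussL1 ha z] with x h1 h2
    rw [h1, Pi.smul_apply, h2, smul_eq_mul, mul_comm]

/-- The heat semigroup as an `L¹`-valued superposition of Gaussians. -/
theorem heatAverage_eq_integral {a r : ℝ} (ha : 0 < a) (hr : 0 < r) (u : L1) :
    heatAverage a r u = ∫ z, u z • gaussL1 (a * r ^ 2) z :=
  Lp.ext ((coeFn_heatAverage ha hr u).trans
    (coeFn_integral_smul_gaussL1 (by positivity) u).symm)

theorem heatAverage_gaussL1 {a b r : ℝ} (ha : 0 < a) (hb : 0 < b) (hr : 0 < r) (z : Plane) :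
    heatAverage a r (gaussL1 b z) = gaussL1 (a * r ^ 2 + b) z := by
  refine Lp.ext ?_
  filter_upwards [coeFn_heatAverage ha hr (gaussL1 b z),
    coeFn_gaussL1 (by positivity : 0 < a * r ^ 2 + b) z] with x h1 h2
  rw [h1, h2, ← integral_gauss_mul_gauss (by positivity) hb]
  refine integral_congr_ae ((coeFn_gaussL1 hb z).mono fun y hy => ?_)
  simp only [hy]

theorem continuous_heatAverage {a : ℝ} (ha : 0 < a) (u : L1) :
    Continuous fun r => heatAverage a r u := by
  simp only [heatAverage_apply ha]
  refine continuous_of_dominated (bound := fun y => gauss a y * ‖u‖)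
    (fun r => (integrable_gauss_smul_translate ha r u).aestronglyMeasurable)
    (fun r => Eventually.of_forall fun y => ?_) ((integrable_gauss ha).mul_const _)
    (Eventually.of_forall fun y => ?_)
  · rw [norm_smul, norm_translate, Real.norm_of_nonneg (gauss_pos ha y).le]
  · have h : Continuous fun r : ℝ => r • y := by fun_prop
    exact Continuous.const_smul ((continuous_translate u).comp h) (gauss a y)

theorem heatSemigroup_eq {ε : ℝ} (hε : 0 < ε) (t : ℝ) :
    heatSemigroup ε t = heatAverage (4 * ε ^ 2) (Real.sqrt t) := by
  have ha : 0 < 4 * ε ^ 2 := by positivity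
  refine operatorOfFormula_eq fun u => ?_
  by_cases ht : 0 < t
  · simp only [if_pos ht, heatKernel_eq_gauss]
    have := coeFn_heatAverage ha (Real.sqrt_pos.2 ht) u
    rwa [Real.sq_sqrt ht.le] at this
  · simp only [if_neg ht]
    rw [Real.sqrt_eq_zero_of_nonpos (not_lt.1 ht), heatAverage_zero ha]

theorem norm_heatSemigroup_le {ε : ℝ} (hε : 0 < ε) (t : ℝ) : ‖heatSemigroup ε t‖ ≤ 1 := by
  rw [heatSemigroup_eq hε]
  exact norm_heatAverage_le (by positivity) _

theorem heatSemigroup_eq_integral {ε t : ℝ} (hε : 0 < ε) (ht : 0 < t) (u : L1) :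
    heatSemigroup ε t u = ∫ z, u z • gaussL1 (4 * ε ^ 2 * t) z := by
  rw [heatSemigroup_eq hε, heatAverage_eq_integral (by positivity) (Real.sqrt_pos.2 ht),
    Real.sq_sqrt ht.le]

theorem heatSemigroup_zero {ε : ℝ} (hε : 0 < ε) :
    heatSemigroup ε 0 = ContinuousLinearMap.id ℝ L1 := by
  rw [heatSemigroup_eq hε, Real.sqrt_zero]
  ext1 u
  exact heatAverage_zero (by positivity) u

theorem isC0Semigroup_heatSemigroup {ε : ℝ} (hε : 0 < ε) : IsC0Semigroup (heatSemigroup ε) where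
  zero := heatSemigroup_zero hε
  add s t hs ht := by
    have ha : 0 < 4 * ε ^ 2 := by positivity
    rcases hs.eq_or_lt with rfl | hs
    · rw [heatSemigroup_zero hε, zero_add]
      rfl
    rcases ht.eq_or_lt with rfl | ht
    · rw [heatSemigroup_zero hε, add_zero]
      rfl
    ext1 u
    rw [ContinuousLinearMap.comp_apply, heatSemigroup_eq_integral hε ht,
      heatSemigroup_eq_integral hε (add_pos hs ht),
      ← ContinuousLinearMap.integral_comp_comm _ (integrable_smul_gaussL1 (by positivity) u)]
    refine integral_congr_ae (Eventually.of_forall fun z => ?_)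
    simp only [map_smul]
    rw [heatSemigroup_eq hε, heatAverage_gaussL1 ha (by positivity) (Real.sqrt_pos.2 hs),
      Real.sq_sqrt hs.le, mul_add]
  continuousOn u := by
    simp only [heatSemigroup_eq hε]
    exact ((continuous_heatAverage (by positivity) u).comp Real.continuous_sqrt).continuousOn

theorem heatSemigroup_nonneg {ε : ℝ} (hε : 0 < ε) {t : ℝ} (ht : 0 < t) {u : L1} (hu : 0 ≤ u) :
    0 ≤ heatSemigroup ε t u := by
  have ha : 0 < 4 * ε ^ 2 * t := by positivity
  rw [heatSemigroup_eq_integral hε ht, ← Lp.coeFn_nonneg]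
  filter_upwards [coeFn_integral_smul_gaussL1 ha u] with x hx
  rw [hx]
  refine integral_nonneg_of_ae ?_
  filter_upwards [(Lp.coeFn_nonneg u).2 hu] with z hz
  exact mul_nonneg (gauss_pos ha _).le hz

/-! ### Integral curves and the flow of the velocity field -/

/-- Gronwall's inequality for two integral curves, in both time directions. -/
theorem dist_le_exp_mul_dist {E : Type*} [NormedAddCommGroup E] [NormedSpace ℝ E] {F : E → E}
    {K : NNReal} (hF : LipschitzWith K F) {γ₁ γ₂ : ℝ → E}
    (h₁ : ∀ s, HasDerivAt γ₁ (F (γ₁ s)) s) (h₂ : ∀ s, HasDerivAt γ₂ (F (γ₂ s)) s) (s t : ℝ) :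
    dist (γ₁ t) (γ₂ t) ≤ dist (γ₁ s) (γ₂ s) * Real.exp (K * |t - s|) := by
  rcases le_total s t with h | h
  · rw [abs_of_nonneg (sub_nonneg.2 h)]
    exact dist_le_of_trajectories_ODE (v := fun _ => F) (fun _ => hF)
      (HasDerivAt.continuousOn fun r _ => h₁ r) (fun r _ => (h₁ r).hasDerivWithinAt)
      (HasDerivAt.continuousOn fun r _ => h₂ r) (fun r _ => (h₂ r).hasDerivWithinAt) le_rfl
      t ⟨h, le_rfl⟩
  · rw [abs_sub_comm, abs_of_nonneg (sub_nonneg.2 h)]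
    have hr : ∀ γ : ℝ → E, (∀ s, HasDerivAt γ (F (γ s)) s) →
        ∀ r, HasDerivAt (fun r => γ (-r)) (-F (γ (-r))) r := fun γ hγ r => by
      have h := (hγ (-r)).scomp r (hasDerivAt_neg r)
      rw [neg_one_smul] at h
      exact h
    have := dist_le_of_trajectories_ODE (v := fun _ x => -F x) (a := -s) (b := -t)
      (f := fun r => γ₁ (-r)) (g := fun r => γ₂ (-r)) (fun _ => hF.neg)
      (HasDerivAt.continuousOn fun r _ => hr γ₁ h₁ r) (fun r _ => (hr γ₁ h₁ r).hasDerivWithinAt)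
      (HasDerivAt.continuousOn fun r _ => hr γ₂ h₂ r) (fun r _ => (hr γ₂ h₂ r).hasDerivWithinAt)
      le_rfl (-t) ⟨neg_le_neg h, le_rfl⟩
    simp only [neg_neg] at this
    rwa [neg_sub_neg] at this

/-- A bounded Lipschitz vector field has global integral curves. Boundedness makes the
Picard–Lindelöf theorem applicable on `[-τ, τ]` for every `τ`; by uniqueness these curves agree. -/
theorem exists_integralCurve {E : Type*} [NormedAddCommGroup E] [NormedSpace ℝ E] [CompleteSpace E]
    {F : E → E} {K : NNReal} (hF : LipschitzWith K F) {M : NNReal} (hM : ∀ x, ‖F x‖ ≤ M) (z : E) :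
    ∃ γ : ℝ → E, γ 0 = z ∧ ∀ s, HasDerivAt γ (F (γ s)) s := by
  have hloc : ∀ τ : ℝ, ∃ γ : ℝ → E, 0 < τ → γ 0 = z ∧
      ∀ s ∈ Ioo (-τ) τ, HasDerivAt γ (F (γ s)) s := by
    intro τ
    by_cases hτ : 0 < τ
    · have hPL : IsPicardLindelof (fun _ => F) (tmin := -τ) (tmax := τ)
          ⟨0, by constructor <;> linarith⟩ z (M * τ.toNNReal) 0 M K := by
        refine IsPicardLindelof.of_time_independent (fun x _ => hM x) hF.lipschitzOnWith ?_
        simp [Real.coe_toNNReal τ hτ.le]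
      obtain ⟨γ, h0, hγ⟩ := hPL.exists_eq_forall_mem_Icc_hasDerivWithinAt₀
      exact ⟨γ, fun _ => ⟨h0, fun s hs => (hγ s ⟨hs.1.le, hs.2.le⟩).hasDerivAt
        (Icc_mem_nhds hs.1 hs.2)⟩⟩
    · exact ⟨fun _ => z, fun h => absurd h hτ⟩
  choose γ hγ using hloc
  have hEq : ∀ a b : ℝ, 0 < a → a ≤ b → EqOn (γ a) (γ b) (Ioo (-a) a) := by
    intro a b ha hab
    have hb := ha.trans_le hab
    refine ODE_solution_unique_of_mem_Ioo (v := fun _ => F) (s := fun _ => univ) (t₀ := 0)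
      (fun _ _ => hF.lipschitzOnWith) ⟨by linarith, ha⟩
      (fun t ht => ⟨(hγ a ha).2 t ht, mem_univ _⟩)
      (fun t ht => ⟨(hγ b hb).2 t ⟨by linarith [ht.1], by linarith [ht.2]⟩, mem_univ _⟩) ?_
    rw [(hγ a ha).1, (hγ b hb).1]
  refine ⟨fun t => γ (|t| + 1) t, (hγ _ (by positivity)).1, fun s => ?_⟩
  have hs : s ∈ Ioo (-(|s| + 1)) (|s| + 1) := abs_lt.1 (lt_add_one _)
  refine ((hγ (|s| + 1) (by positivity)).2 s hs).congr_of_eventuallyEq ?_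
  filter_upwards [Ioo_mem_nhds hs.1 hs.2] with t ht
  have ht' : t ∈ Ioo (-(|t| + 1)) (|t| + 1) := abs_lt.1 (lt_add_one _)
  rcases le_total (|t| + 1) (|s| + 1) with h | h
  · exact hEq _ _ (by positivity) h ht'
  · exact (hEq _ _ (by positivity) h ht).symm

namespace IsAdmissibleVelocity

theorem exists_norm_le {C : Plane → Plane} (hC : IsAdmissibleVelocity C) :
    ∃ M : NNReal, ∀ x, ‖C x‖ ≤ M := by
  obtain ⟨M, hM⟩ := hC.bounded
  exact ⟨M.toNNReal, fun x => (hM x).trans (Real.le_coe_toNNReal M)⟩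

theorem exists_lipschitzWith {C : Plane → Plane} (hC : IsAdmissibleVelocity C) :
    ∃ K : NNReal, LipschitzWith K C := by
  choose M hM using hC.partialDeriv_bounded
  have hM0 : ∀ i, 0 ≤ M i := fun i => (norm_nonneg _).trans (hM i 0)
  refine ⟨(∑ i, M i).toNNReal, lipschitzWith_of_nnnorm_fderiv_le
    (hC.contDiff.differentiable one_ne_zero) fun x => ?_⟩
  rw [← NNReal.coe_le_coe, coe_nnnorm, Real.coe_toNNReal _ (Finset.sum_nonneg fun i _ => hM0 i)]
  refine ContinuousLinearMap.opNorm_le_bound _ (Finset.sum_nonneg fun i _ => hM0 i) fun v => ?_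
  have hv : v = ∑ i, v i • EuclideanSpace.single i (1 : ℝ) := by
    ext j
    fin_cases j <;> simp
  rw [hv, map_sum, ← hv, Finset.sum_mul]
  refine (norm_sum_le _ _).trans (Finset.sum_le_sum fun i _ => ?_)
  rw [map_smul, norm_smul, mul_comm]
  exact mul_le_mul (hM i x) (PiLp.norm_apply_le v i) (norm_nonneg _) (hM0 i)

theorem exists_abs_divergence_le {C : Plane → Plane} (hC : IsAdmissibleVelocity C) :
    ∃ D : ℝ, 0 ≤ D ∧ ∀ x, |divergence C x| ≤ D := by
  choose M hM using hC.partialDeriv_bounded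
  have hM0 : ∀ i, 0 ≤ M i := fun i => (norm_nonneg _).trans (hM i 0)
  refine ⟨∑ i, M i, Finset.sum_nonneg fun i _ => hM0 i, fun x => ?_⟩
  refine (Finset.abs_sum_le_sum_abs _ _).trans (Finset.sum_le_sum fun i _ => ?_)
  exact (PiLp.norm_apply_le (partialDeriv C i x) i).trans (hM i x)

theorem continuous_divergence {C : Plane → Plane} (hC : IsAdmissibleVelocity C) :
    Continuous (divergence C) := by
  unfold divergence
  refine continuous_finsetSum _ fun i _ => ?_
  have := (hC.partialDeriv_uniformContinuous i).continuous
  fun_prop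

end IsAdmissibleVelocity

variable {C : Plane → Plane}

/-- The flow of `C` run backwards, that is, the flow of `-C`: the characteristics of the convection
semigroup. -/
def backflow (C : Plane → Plane) (t : ℝ) (x : Plane) : Plane := flow C (-t) x


theorem flow_spec (hC : IsAdmissibleVelocity C) (z : Plane) :
    flow C 0 z = z ∧ ∀ s, HasDerivAt (fun t => flow C t z) (C (flow C s z)) s := by
  obtain ⟨M, hM⟩ := hC.exists_norm_le
  obtain ⟨K, hK⟩ := hC.exists_lipschitzWith
  have h := exists_integralCurve hK hM z
  have e : ∀ t, flow C t z = Classical.choose h t := fun t => by rw [flow, dif_pos h]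
  simp only [e]
  exact Classical.choose_spec h

theorem backflow_zero (hC : IsAdmissibleVelocity C) (x : Plane) : backflow C 0 x = x := by
  rw [backflow, neg_zero]
  exact (flow_spec hC x).1

theorem hasDerivAt_backflow (hC : IsAdmissibleVelocity C) (x : Plane) (s : ℝ) :
    HasDerivAt (fun t => backflow C t x) (-C (backflow C s x)) s := by
  have h := ((flow_spec hC x).2 (-s)).scomp s (hasDerivAt_neg s)
  rw [neg_one_smul] at h
  exact h

theorem lipschitzWith_backflow (hC : IsAdmissibleVelocity C) {M : NNReal} (hM : ∀ x, ‖C x‖ ≤ M)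
    (x : Plane) : LipschitzWith M (fun t => backflow C t x) := by
  refine lipschitzWith_of_nnnorm_deriv_le
    (fun t => (hasDerivAt_backflow hC x t).differentiableAt) fun t => ?_
  rw [(hasDerivAt_backflow hC x t).deriv, nnnorm_neg]
  exact hM _

theorem dist_backflow_backflow_le (hC : IsAdmissibleVelocity C) {K : NNReal}
    (hK : LipschitzWith K C) (x y : Plane) (s t : ℝ) :
    dist (backflow C t x) (backflow C t y)
      ≤ dist (backflow C s x) (backflow C s y) * Real.exp (K * |t - s|) :=
  dist_le_exp_mul_dist (F := fun x => -C x) hK.neg (hasDerivAt_backflow hC x)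
    (hasDerivAt_backflow hC y) s t

theorem continuous_uncurry_backflow (hC : IsAdmissibleVelocity C) :
    Continuous fun p : ℝ × Plane => backflow C p.1 p.2 := by
  obtain ⟨M, hM⟩ := hC.exists_norm_le
  obtain ⟨K, hK⟩ := hC.exists_lipschitzWith
  refine continuous_prod_of_continuous_lipschitzWith _ M (fun t => ?_)
    (fun x => lipschitzWith_backflow hC hM x)
  refine LipschitzWith.continuous (K := (Real.exp (K * |t|)).toNNReal)
    (LipschitzWith.of_dist_le_mul fun x y => ?_)
  have := dist_backflow_backflow_le hC hK x y 0 t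
  rw [backflow_zero hC, backflow_zero hC, sub_zero, mul_comm] at this
  rwa [Real.coe_toNNReal _ (Real.exp_pos _).le]

theorem continuous_backflow (hC : IsAdmissibleVelocity C) (t : ℝ) : Continuous (backflow C t) :=
  (continuous_uncurry_backflow hC).comp (Continuous.prodMk_right t)

/-- An antilipschitz map of the plane distorts area by at most the square of its constant, because
Lebesgue measure is a multiple of the two-dimensional Hausdorff measure. -/
theorem volume_preimage_le_of_antilipschitz {K : NNReal} {f : Plane → Plane}
    (hf : AntilipschitzWith K f) (s : Set Plane) :
    volume (f ⁻¹' s) ≤ (K : ENNReal) ^ 2 * volume s := by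
  set μ : Measure Plane := Measure.hausdorffMeasure (Module.finrank ℝ Plane) with hμ
  have h1 : (volume : Measure Plane) = (volume : Measure Plane).addHaarScalarFactor μ • μ :=
    Measure.isAddLeftInvariant_eq_smul _ _
  have h2 := hf.hausdorffMeasure_preimage_le (Nat.cast_nonneg (Module.finrank ℝ Plane)) s
  rw [finrank_euclideanSpace_fin] at h2 hμ
  rw [h1, Measure.smul_apply, Measure.smul_apply, mul_smul_comm]
  refine smul_le_smul_of_nonneg_left ?_ zero_le
  rw [hμ]
  simpa using h2

/-- Area distortion along characteristics, from Gronwall's inequality in place of Liouville's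
formula. -/
theorem map_backflow_le (hC : IsAdmissibleVelocity C) {K : NNReal} (hK : LipschitzWith K C) {t : ℝ}
    (ht : 0 ≤ t) :
    Measure.map (backflow C t) volume ≤ ENNReal.ofReal (Real.exp (2 * K * t)) • volume := by
  have ha : AntilipschitzWith (Real.exp (K * t)).toNNReal (backflow C t) := by
    refine AntilipschitzWith.of_le_mul_dist fun x y => ?_
    have := dist_backflow_backflow_le hC hK x y t 0
    rwa [backflow_zero hC, backflow_zero hC, zero_sub, abs_neg, abs_of_nonneg ht, mul_comm,
      ← Real.coe_toNNReal _ (Real.exp_pos (K * t)).le] at this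
  refine Measure.le_iff.2 fun s hs => ?_
  rw [Measure.map_apply (continuous_backflow hC t).measurable hs, Measure.smul_apply, smul_eq_mul]
  refine (volume_preimage_le_of_antilipschitz ha s).trans (le_of_eq ?_)
  congr 1
  rw [← ENNReal.ofReal, ← ENNReal.ofReal_pow (Real.exp_pos _).le, ← Real.exp_nat_mul]
  congr 2
  push_cast
  ring

theorem quasiMeasurePreserving_backflow (hC : IsAdmissibleVelocity C) {t : ℝ} (ht : 0 ≤ t) :
    Measure.QuasiMeasurePreserving (backflow C t) volume volume := by
  obtain ⟨K, hK⟩ := hC.exists_lipschitzWith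
  exact ⟨(continuous_backflow hC t).measurable, (map_backflow_le hC hK ht).absolutelyContinuous.trans
    Measure.smul_absolutelyContinuous⟩

theorem lintegral_comp_backflow_le (hC : IsAdmissibleVelocity C) {K : NNReal}
    (hK : LipschitzWith K C) {t : ℝ} (ht : 0 ≤ t) {f : Plane → ENNReal} (hf : Measurable f) :
    ∫⁻ x, f (backflow C t x) ≤ ENNReal.ofReal (Real.exp (2 * K * t)) * ∫⁻ x, f x := by
  rw [← lintegral_map hf (continuous_backflow hC t).measurable, ← smul_eq_mul,
    ← lintegral_smul_measure]
  exact lintegral_mono' (map_backflow_le hC hK ht) le_rfl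

/-! ### The convection semigroup -/

theorem L1.lintegral_enorm (u : L1) : ∫⁻ x, ‖u x‖ₑ = ENNReal.ofReal ‖u‖ :=
  (MeasureTheory.L1.ofReal_norm_eq_lintegral u).symm

theorem L1.norm_le_of_lintegral {u : L1} {f : Plane → ℝ} (hu : u =ᵐ[volume] f) {c : ℝ}
    (hc : 0 ≤ c) (h : ∫⁻ x, ‖f x‖ₑ ≤ ENNReal.ofReal c) : ‖u‖ ≤ c := by
  refine (ENNReal.ofReal_le_ofReal_iff hc).1 ?_
  rw [← L1.lintegral_enorm]
  exact (lintegral_congr_ae (hu.mono fun x hx => by simp only [hx])).trans_le h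

/-- The exponential factor in the formula for the convection semigroup. -/
def convectionFactor (C : Plane → Plane) (t : ℝ) (x : Plane) : ℝ :=
  Real.exp (-∫ σ in (0 : ℝ)..t, divergence C (backflow C σ x))


theorem continuous_uncurry_divergence_backflow (hC : IsAdmissibleVelocity C) :
    Continuous fun p : Plane × ℝ => divergence C (backflow C p.2 p.1) :=
  hC.continuous_divergence.comp ((continuous_uncurry_backflow hC).comp continuous_swap)

theorem continuous_uncurry_convectionFactor (hC : IsAdmissibleVelocity C) :
    Continuous fun p : ℝ × Plane => convectionFactor C p.1 p.2 := by
  unfold convectionFactor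
  refine Real.continuous_exp.comp (Continuous.neg ?_)
  refine intervalIntegral.continuous_parametric_intervalIntegral_of_continuous
    (f := fun (p : ℝ × Plane) σ => divergence C (backflow C σ p.2)) ?_ continuous_fst
  exact (continuous_uncurry_divergence_backflow hC).comp
    ((continuous_snd.comp continuous_fst).prodMk continuous_snd)

theorem hasDerivAt_convectionFactor (hC : IsAdmissibleVelocity C) (x : Plane) (t : ℝ) :
    HasDerivAt (fun t => convectionFactor C t x)
      (convectionFactor C t x * -divergence C (backflow C t x)) t := by
  have hc : Continuous fun σ => divergence C (backflow C σ x) :=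
    (continuous_uncurry_divergence_backflow hC).comp (Continuous.prodMk_right x)
  exact (hc.integral_hasStrictDerivAt 0 t).hasDerivAt.neg.exp

theorem convectionFactor_zero (x : Plane) : convectionFactor C 0 x = 1 := by
  simp [convectionFactor]

theorem convectionFactor_pos (t : ℝ) (x : Plane) : 0 < convectionFactor C t x := Real.exp_pos _

theorem convectionFactor_le {D : ℝ} (hD : ∀ x, |divergence C x| ≤ D) {t : ℝ} (ht : 0 ≤ t)
    (x : Plane) : convectionFactor C t x ≤ Real.exp (D * t) := by
  refine Real.exp_le_exp.2 ((neg_le_abs _).trans ?_)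
  have := intervalIntegral.norm_integral_le_of_norm_le_const (a := 0) (b := t) (C := D)
    (f := fun σ => divergence C (backflow C σ x)) fun σ _ => hD _
  rwa [sub_zero, abs_of_nonneg ht] at this

theorem lintegral_convection_le (hC : IsAdmissibleVelocity C) {D : ℝ}
    (hD : ∀ x, |divergence C x| ≤ D) {K : NNReal} (hK : LipschitzWith K C) {t : ℝ} (ht : 0 ≤ t)
    {f : Plane → ℝ} (hf : Measurable f) :
    ∫⁻ x, ‖convectionFactor C t x * f (backflow C t x)‖ₑ
      ≤ ENNReal.ofReal (Real.exp ((D + 2 * K) * t)) * ∫⁻ x, ‖f x‖ₑ := by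
  have h1 : ∀ x, ‖convectionFactor C t x * f (backflow C t x)‖ₑ
      ≤ ENNReal.ofReal (Real.exp (D * t)) * ‖f (backflow C t x)‖ₑ := by
    intro x
    rw [enorm_mul, Real.enorm_of_nonneg (convectionFactor_pos t x).le]
    exact mul_le_mul_left (ENNReal.ofReal_le_ofReal (convectionFactor_le hD ht x)) _
  refine (lintegral_mono h1).trans ?_
  rw [lintegral_const_mul' _ _ ENNReal.ofReal_ne_top, add_mul, Real.exp_add,
    ENNReal.ofReal_mul (Real.exp_pos _).le, mul_assoc]
  exact mul_le_mul_right (lintegral_comp_backflow_le hC hK ht hf.enorm) _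

/-- The formula defining the convection semigroup gives a bounded operator. It does not depend on the
representative of `u` since the backward flow is quasi-measure-preserving. -/
theorem exists_convection_operator (hC : IsAdmissibleVelocity C) {D : ℝ}
    (hD : ∀ x, |divergence C x| ≤ D) {K : NNReal} (hK : LipschitzWith K C) {t : ℝ} (ht : 0 ≤ t) :
    ∃ S : L1 →L[ℝ] L1, ‖S‖ ≤ Real.exp ((D + 2 * K) * t) ∧
      ∀ u : L1, S u =ᵐ[volume] fun x => convectionFactor C t x * u (backflow C t x) := by
  have hfm : Measurable (convectionFactor C t) :=
    ((continuous_uncurry_convectionFactor hC).comp (Continuous.prodMk_right t)).measurable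
  have hle : ∀ u : L1, ∫⁻ x, ‖convectionFactor C t x * u (backflow C t x)‖ₑ
      ≤ ENNReal.ofReal (Real.exp ((D + 2 * K) * t) * ‖u‖) := fun u => by
    rw [ENNReal.ofReal_mul (Real.exp_pos _).le, ← L1.lintegral_enorm]
    exact lintegral_convection_le hC hD hK ht (Lp.stronglyMeasurable u).measurable
  have hint : ∀ u : L1, Integrable (fun x => convectionFactor C t x * u (backflow C t x)) volume :=
    fun u => ⟨(hfm.mul ((Lp.stronglyMeasurable u).measurable.comp
      (continuous_backflow hC t).measurable)).aestronglyMeasurable,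
      (hle u).trans_lt ENNReal.ofReal_lt_top⟩
  have hq := quasiMeasurePreserving_backflow hC ht
  refine ⟨LinearMap.mkContinuous
    { toFun := fun u => (hint u).toL1 _
      map_add' := fun u v => by
        refine Lp.ext ?_
        filter_upwards [(hint (u + v)).coeFn_toL1, (hint u).coeFn_toL1, (hint v).coeFn_toL1,
          Lp.coeFn_add ((hint u).toL1 _) ((hint v).toL1 _), hq.ae_eq_comp (Lp.coeFn_add u v)]
          with x h1 h2 h3 h4 h5
        simp only [Function.comp_apply, Pi.add_apply] at h5
        rw [h1, h4, Pi.add_apply, h2, h3, h5, mul_add]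
      map_smul' := fun c u => by
        refine Lp.ext ?_
        filter_upwards [(hint (c • u)).coeFn_toL1, (hint u).coeFn_toL1,
          Lp.coeFn_smul c ((hint u).toL1 _), hq.ae_eq_comp (Lp.coeFn_smul c u)]
          with x h1 h2 h4 h5
        simp only [Function.comp_apply, Pi.smul_apply, smul_eq_mul] at h5
        rw [h1, RingHom.id_apply, h4, Pi.smul_apply, h2, h5, smul_eq_mul]
        ring } (Real.exp ((D + 2 * K) * t)) (fun u => L1.norm_le_of_lintegral
          (hint u).coeFn_toL1 (by positivity) (hle u)),
    LinearMap.mkContinuous_norm_le _ (Real.exp_pos _).le _, fun u => (hint u).coeFn_toL1⟩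

theorem coeFn_convectionSemigroup (hC : IsAdmissibleVelocity C) {t : ℝ} (ht : 0 ≤ t) (u : L1) :
    convectionSemigroup C t u =ᵐ[volume]
      fun x => convectionFactor C t x * u (backflow C t x) := by
  obtain ⟨D, -, hD⟩ := hC.exists_abs_divergence_le
  obtain ⟨K, hK⟩ := hC.exists_lipschitzWith
  obtain ⟨S, -, hS⟩ := exists_convection_operator hC hD hK ht
  have : convectionSemigroup C t = S := operatorOfFormula_eq hS
  rw [this]
  exact hS u

theorem norm_convectionSemigroup_le (hC : IsAdmissibleVelocity C) {D : ℝ}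
    (hD : ∀ x, |divergence C x| ≤ D) {K : NNReal} (hK : LipschitzWith K C) {t : ℝ} (ht : 0 ≤ t) :
    ‖convectionSemigroup C t‖ ≤ Real.exp ((D + 2 * K) * t) := by
  obtain ⟨S, hSn, hS⟩ := exists_convection_operator hC hD hK ht
  have : convectionSemigroup C t = S := operatorOfFormula_eq hS
  rwa [this]

theorem convectionSemigroup_nonneg (hC : IsAdmissibleVelocity C) {t : ℝ} (ht : 0 ≤ t) {u : L1}
    (hu : 0 ≤ u) : 0 ≤ convectionSemigroup C t u := by
  rw [← Lp.coeFn_nonneg]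
  filter_upwards [coeFn_convectionSemigroup hC ht u,
    (quasiMeasurePreserving_backflow hC ht).ae ((Lp.coeFn_nonneg u).2 hu)] with x h1 h2
  rw [h1]
  exact mul_nonneg (convectionFactor_pos t x).le h2

/-! ### The convection semigroup on Gaussians -/

/-- The function `-∇·(w C)` for the Gaussian `w = gauss a (· - z)`. -/
def gaussFlux (C : Plane → Plane) (a : ℝ) (z y : Plane) : ℝ :=
  gauss a (y - z) * (2 * inner ℝ (y - z) (C y) / a - divergence C y)

theorem continuous_gaussFlux (hC : IsAdmissibleVelocity C) (a : ℝ) (z : Plane) :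
    Continuous (gaussFlux C a z) := by
  have h1 := hC.continuous_divergence
  have h2 := hC.contDiff.continuous
  have h3 := continuous_gauss a
  unfold gaussFlux
  fun_prop

/-- The convected Gaussian `S t w` evolves pointwise with velocity `S t (-∇·(w C))`. -/
theorem hasDerivAt_convection_gauss (hC : IsAdmissibleVelocity C) (a : ℝ) (z x : Plane) (t : ℝ) :
    HasDerivAt (fun t => convectionFactor C t x * gauss a (backflow C t x - z))
      (convectionFactor C t x * gaussFlux C a z (backflow C t x)) t := by
  have h1 := ((hasDerivAt_backflow hC x t).sub_const z).norm_sq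
  have h2 := ((h1.neg.div_const a).exp.const_mul (Real.pi * a)⁻¹)
  refine ((hasDerivAt_convectionFactor hC x t).mul h2).congr_deriv ?_
  rw [gaussFlux, gauss, inner_neg_right]
  simp only [Pi.neg_apply]
  ring

/-- The factor `1 / √a` is the gain that makes convection a small perturbation of diffusion. It comes
from `|v| exp (-|v|² / (2a)) ≤ √a`, at the price of doubling the width of the Gaussian. -/
theorem abs_gaussFlux_le {a : ℝ} (ha : 0 < a) {M D : ℝ} (hM : ∀ x, ‖C x‖ ≤ M)
    (hD : ∀ x, |divergence C x| ≤ D) (z y : Plane) :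
    |gaussFlux C a z y| ≤ (4 * M / Real.sqrt a + 2 * D) * gauss (2 * a) (y - z) := by
  have hM0 : 0 ≤ M := (norm_nonneg _).trans (hM 0)
  have hD0 : 0 ≤ D := (abs_nonneg _).trans (hD 0)
  have hsa : 0 < Real.sqrt a := Real.sqrt_pos.2 ha
  have hss : Real.sqrt a * Real.sqrt a = a := Real.mul_self_sqrt ha.le
  generalize hv : y - z = v
  have hG : gauss a v = 2 * gauss (2 * a) v * Real.exp (-‖v‖ ^ 2 / (2 * a)) := by
    have e : -‖v‖ ^ 2 / a = -‖v‖ ^ 2 / (2 * a) + -‖v‖ ^ 2 / (2 * a) := by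
      field_simp; norm_num
    rw [gauss, gauss, e, Real.exp_add]
    field_simp
  have hg2 : 0 < gauss (2 * a) v := gauss_pos (by positivity) v
  have hexp : Real.exp (-‖v‖ ^ 2 / (2 * a)) ≤ 1 :=
    Real.exp_le_one_iff.2 (div_nonpos_of_nonpos_of_nonneg (neg_nonpos.2 (sq_nonneg _))
      (by positivity))
  -- `r e^{-r²/2} ≤ 1` with `r = ‖v‖ / √a`
  have hr : ‖v‖ * Real.exp (-‖v‖ ^ 2 / (2 * a)) ≤ Real.sqrt a := by
    have h1 : ‖v‖ / Real.sqrt a ≤ Real.exp (‖v‖ ^ 2 / (2 * a)) := by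
      have h2 : (‖v‖ / Real.sqrt a) ^ 2 / 2 = ‖v‖ ^ 2 / (2 * a) := by
        rw [div_pow, Real.sq_sqrt ha.le]; field_simp
      have h3 := Real.add_one_le_exp (‖v‖ ^ 2 / (2 * a))
      nlinarith [sq_nonneg (‖v‖ / Real.sqrt a - 1)]
    rw [neg_div, Real.exp_neg, ← div_eq_mul_inv, div_le_iff₀ (Real.exp_pos _), mul_comm]
    rwa [div_le_iff₀ hsa] at h1
  have h4 : |2 * inner ℝ v (C y) / a - divergence C y| ≤ 2 * (‖v‖ * M) / a + D := by
    refine (abs_sub _ _).trans (add_le_add ?_ (hD y))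
    rw [abs_div, abs_of_pos ha, abs_mul, abs_two]
    have := (abs_real_inner_le_norm v (C y)).trans
      (mul_le_mul_of_nonneg_left (hM y) (norm_nonneg v))
    gcongr
  rw [gaussFlux, hv, abs_mul, abs_of_pos (gauss_pos ha v), hG]
  set E := Real.exp (-‖v‖ ^ 2 / (2 * a)) with hE
  have hE0 : 0 < E := Real.exp_pos _
  calc 2 * gauss (2 * a) v * E * |2 * inner ℝ v (C y) / a - divergence C y|
      ≤ 2 * gauss (2 * a) v * E * (2 * (‖v‖ * M) / a + D) := by gcongr
    _ = gauss (2 * a) v * (4 * M * (‖v‖ * E) / a + 2 * D * E) := by ring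
    _ ≤ gauss (2 * a) v * (4 * M * Real.sqrt a / a + 2 * D * 1) := by gcongr
    _ = (4 * M / Real.sqrt a + 2 * D) * gauss (2 * a) v := by
      have : 4 * M * Real.sqrt a / a = 4 * M / Real.sqrt a := by
        rw [div_eq_div_iff ha.ne' hsa.ne', mul_assoc, hss]
      rw [this]; ring

/-- Moving the argument a bounded distance is absorbed by a constant and a wider Gaussian, since
`|w|² ≤ 2 |v|² + 2 M²`. -/
theorem gauss_le_of_norm_sub_le {a : ℝ} (ha : 0 < a) {v w : Plane} {M : ℝ} (h : ‖v - w‖ ≤ M) :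
    gauss a v ≤ 2 * Real.exp (M ^ 2 / a) * gauss (2 * a) w := by
  have h1 : ‖w‖ ^ 2 ≤ 2 * ‖v‖ ^ 2 + 2 * M ^ 2 := by
    have h2 : ‖w‖ ≤ ‖v‖ + M := by
      have := norm_sub_norm_le w v
      rw [norm_sub_rev] at this
      linarith
    have h3 : ‖w‖ ^ 2 ≤ (‖v‖ + M) ^ 2 := pow_le_pow_left₀ (norm_nonneg _) h2 2
    nlinarith [sq_nonneg (‖v‖ - M)]
  have h4 : -‖v‖ ^ 2 / a ≤ M ^ 2 / a + -‖w‖ ^ 2 / (2 * a) := by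
    have e : M ^ 2 / a + -‖w‖ ^ 2 / (2 * a) - -‖v‖ ^ 2 / a
        = (2 * ‖v‖ ^ 2 + 2 * M ^ 2 - ‖w‖ ^ 2) / (2 * a) := by
      field_simp; ring
    have : 0 ≤ (2 * ‖v‖ ^ 2 + 2 * M ^ 2 - ‖w‖ ^ 2) / (2 * a) :=
      div_nonneg (by linarith) (by positivity)
    linarith
  have h5 := Real.exp_le_exp.2 h4
  rw [Real.exp_add] at h5
  have e : 2 * Real.exp (M ^ 2 / a) * gauss (2 * a) w
      = (Real.pi * a)⁻¹ * (Real.exp (M ^ 2 / a) * Real.exp (-‖w‖ ^ 2 / (2 * a))) := by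
    rw [gauss]; field_simp
  rw [e, gauss]
  exact mul_le_mul_of_nonneg_left h5 (by positivity)

theorem coeFn_convectionSemigroup_gaussL1 (hC : IsAdmissibleVelocity C) {t a : ℝ} (ht : 0 ≤ t)
    (ha : 0 < a) (z : Plane) : convectionSemigroup C t (gaussL1 a z) =ᵐ[volume]
      fun x => convectionFactor C t x * gauss a (backflow C t x - z) := by
  filter_upwards [coeFn_convectionSemigroup hC ht (gaussL1 a z),
    (quasiMeasurePreserving_backflow hC ht).ae_eq_comp (coeFn_gaussL1 ha z)] with x h1 h2
  simp only [Function.comp_apply] at h2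
  rw [h1, h2]

/-- Integrate the flux along characteristics over `[0, h]` and exchange the two integrals. -/
theorem norm_convectionSemigroup_gaussL1_sub_le (hC : IsAdmissibleVelocity C) {M : NNReal} {D : ℝ}
    (hM : ∀ x, ‖C x‖ ≤ M) (hD : ∀ x, |divergence C x| ≤ D) {K : NNReal} (hK : LipschitzWith K C)
    {a : ℝ} (ha : 0 < a) (z : Plane) {h : ℝ} (hh : 0 < h) :
    ‖convectionSemigroup C h (gaussL1 a z) - gaussL1 a z‖
      ≤ h * (Real.exp ((D + 2 * K) * h) * (4 * M / Real.sqrt a + 2 * D)) := by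
  have hD0 : 0 ≤ D := (abs_nonneg _).trans (hD 0)
  set c : ℝ := 4 * M / Real.sqrt a + 2 * D with hc
  have hc0 : 0 ≤ c := by positivity
  set f : ℝ → Plane → ℝ := fun s x => convectionFactor C s x * gaussFlux C a z (backflow C s x)
    with hf
  have hfc : Continuous (Function.uncurry f) :=
    (continuous_uncurry_convectionFactor hC).mul
      ((continuous_gaussFlux hC a z).comp (continuous_uncurry_backflow hC))
  have hae : (convectionSemigroup C h (gaussL1 a z) - gaussL1 a z : L1) =ᵐ[volume]
      fun x => ∫ s in (0 : ℝ)..h, f s x := by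
    filter_upwards [Lp.coeFn_sub (convectionSemigroup C h (gaussL1 a z)) (gaussL1 a z),
      coeFn_convectionSemigroup_gaussL1 hC hh.le ha z, coeFn_gaussL1 ha z] with x h1 h2 h3
    rw [intervalIntegral.integral_eq_sub_of_hasDerivAt
      (fun s _ => hasDerivAt_convection_gauss hC a z x s)
      ((hfc.comp (Continuous.prodMk_left x)).intervalIntegrable _ _),
      h1, Pi.sub_apply, h2, h3, backflow_zero hC, convectionFactor_zero, one_mul]
  refine L1.norm_le_of_lintegral hae (by positivity) ?_
  have hflux : ∫⁻ x, ‖gaussFlux C a z x‖ₑ ≤ ENNReal.ofReal c := by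
    have h2a : 0 < 2 * a := by positivity
    calc ∫⁻ x, ‖gaussFlux C a z x‖ₑ
        ≤ ∫⁻ x, ENNReal.ofReal (c * gauss (2 * a) (x - z)) := by
          refine lintegral_mono fun x => ?_
          rw [← ofReal_norm]
          exact ENNReal.ofReal_le_ofReal (abs_gaussFlux_le ha hM hD z x)
      _ = ENNReal.ofReal (∫ x, c * gauss (2 * a) (x - z)) :=
          (ofReal_integral_eq_lintegral_ofReal ((integrable_gauss_sub h2a z).const_mul c)
            (Eventually.of_forall fun x => mul_nonneg hc0 (gauss_pos h2a _).le)).symm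
      _ = ENNReal.ofReal c := by
          rw [integral_const_mul, integral_sub_right_eq_self (gauss (2 * a)), integral_gauss h2a,
            mul_one]
  have hs : ∀ s ∈ Ioc 0 h, ∫⁻ x, ‖f s x‖ₑ
      ≤ ENNReal.ofReal (Real.exp ((D + 2 * K) * h) * c) := by
    intro s hs
    refine (lintegral_convection_le hC hD hK hs.1.le
      (continuous_gaussFlux hC a z).measurable).trans ?_
    rw [ENNReal.ofReal_mul (Real.exp_pos _).le]
    have h1 : (D + 2 * K) * s ≤ (D + 2 * K) * h :=
      mul_le_mul_of_nonneg_left hs.2 (by positivity)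
    gcongr
  calc ∫⁻ x, ‖∫ s in (0 : ℝ)..h, f s x‖ₑ
      ≤ ∫⁻ x, ∫⁻ s in Ioc 0 h, ‖f s x‖ₑ := by
        refine lintegral_mono fun x => ?_
        rw [intervalIntegral.integral_of_le hh.le]
        exact enorm_integral_le_lintegral_enorm _
    _ = ∫⁻ s in Ioc 0 h, ∫⁻ x, ‖f s x‖ₑ :=
        lintegral_lintegral_swap (f := fun x s => ‖f s x‖ₑ)
          (hfc.comp continuous_swap).enorm.measurable.aemeasurable
    _ ≤ ∫⁻ _ in Ioc 0 h, ENNReal.ofReal (Real.exp ((D + 2 * K) * h) * c) :=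
        setLIntegral_mono measurable_const hs
    _ = ENNReal.ofReal (h * (Real.exp ((D + 2 * K) * h) * c)) := by
        rw [setLIntegral_const, Real.volume_Ioc, sub_zero, mul_comm, ENNReal.ofReal_mul hh.le]

/-- Gaussians lie in the domain of the generator of convection: the difference quotients converge
pointwise and are dominated by a wider Gaussian. -/
theorem exists_isGeneratorValue_gaussL1 (hC : IsAdmissibleVelocity C) {a : ℝ} (ha : 0 < a)
    (z : Plane) : ∃ f, IsGeneratorValue (convectionSemigroup C) (gaussL1 a z) f := by
  obtain ⟨M, hM⟩ := hC.exists_norm_le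
  obtain ⟨D, hD0, hD⟩ := hC.exists_abs_divergence_le
  have h2a : 0 < 2 * a := by positivity
  have h4a : 0 < 2 * (2 * a) := by positivity
  set c : ℝ := 4 * M / Real.sqrt a + 2 * D with hc
  have hc0 : 0 ≤ c := by positivity
  -- a common Gaussian majorant of the flux along characteristics for times in `[0, 1]`
  set B : Plane → ℝ := fun x =>
    Real.exp (D * 1) * (c * (2 * Real.exp ((M : ℝ) ^ 2 / (2 * a)) * gauss (2 * (2 * a)) (x - z)))
    with hB
  have hBi : Integrable B volume :=
    (((integrable_gauss_sub h4a z).const_mul _).const_mul _).const_mul _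
  have hbound : ∀ s, 0 ≤ s → s ≤ 1 → ∀ x,
      ‖convectionFactor C s x * gaussFlux C a z (backflow C s x)‖ ≤ B x := by
    intro s hs hs1 x
    rw [norm_mul, Real.norm_of_nonneg (convectionFactor_pos s x).le]
    refine mul_le_mul ?_ ?_ (norm_nonneg _) (Real.exp_pos _).le
    · refine (convectionFactor_le hD hs x).trans (Real.exp_le_exp.2 ?_)
      gcongr
    · refine (abs_gaussFlux_le ha hM hD z _).trans (mul_le_mul_of_nonneg_left ?_ hc0)
      refine gauss_le_of_norm_sub_le h2a ?_
      have := (lipschitzWith_backflow hC hM x).dist_le_mul s 0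
      rw [backflow_zero hC, dist_eq_norm, Real.dist_eq, sub_zero, abs_of_nonneg hs] at this
      rw [sub_sub_sub_cancel_right]
      exact this.trans (by nlinarith [M.coe_nonneg])
  have hflux : Integrable (gaussFlux C a z) volume := by
    refine hBi.mono' (continuous_gaussFlux hC a z).aestronglyMeasurable
      (Eventually.of_forall fun x => ?_)
    simpa [convectionFactor_zero, backflow_zero hC] using hbound 0 le_rfl zero_le_one x
  refine ⟨hflux.toL1 _, ?_⟩
  set q : ℝ → Plane → ℝ := fun h x =>
    h⁻¹ * (convectionFactor C h x * gauss a (backflow C h x - z) - gauss a (x - z)) with hq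
  have hqm : ∀ h, AEStronglyMeasurable (q h) volume := by
    intro h
    refine Continuous.aestronglyMeasurable ?_
    have h1 : Continuous (convectionFactor C h) :=
      (continuous_uncurry_convectionFactor hC).comp (Continuous.prodMk_right h)
    have h2 := continuous_backflow hC h
    have h3 := continuous_gauss a
    simp only [hq]
    fun_prop
  have hev : ∀ᶠ h : ℝ in 𝓝[>] 0, 0 < h ∧ h ≤ 1 := by
    filter_upwards [Ioo_mem_nhdsGT (zero_lt_one' ℝ)] with h hh using ⟨hh.1, hh.2.le⟩
  have hdct : Tendsto (fun h => ∫ x, ‖q h x - gaussFlux C a z x‖) (𝓝[>] 0)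
      (𝓝 (∫ _ : Plane, (0 : ℝ))) := by
    refine tendsto_integral_filter_of_dominated_convergence (fun x => B x + ‖gaussFlux C a z x‖)
      (Eventually.of_forall fun h => ((hqm h).sub hflux.aestronglyMeasurable).norm) ?_
      (hBi.add hflux.norm) (Eventually.of_forall fun x => ?_)
    · filter_upwards [hev] with h hh
      refine Eventually.of_forall fun x => ?_
      rw [norm_norm]
      refine (norm_sub_le _ _).trans (add_le_add_left ?_ _)
      have h1 := norm_image_sub_le_of_norm_deriv_le_segment' (a := 0) (b := h) (C := B x)
        (fun s _ => (hasDerivAt_convection_gauss hC a z x s).hasDerivWithinAt)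
        (fun s hs => hbound s hs.1 (hs.2.le.trans hh.2) x) h ⟨hh.1.le, le_rfl⟩
      rw [backflow_zero hC, convectionFactor_zero, one_mul, sub_zero] at h1
      rw [norm_mul, norm_inv, Real.norm_of_nonneg hh.1.le, inv_mul_le_iff₀ hh.1, mul_comm h]
      exact h1
    · have h1 := (hasDerivAt_convection_gauss hC a z x 0).tendsto_slope_zero_right
      simp only [zero_add, backflow_zero hC, convectionFactor_zero, one_mul, smul_eq_mul] at h1
      exact tendsto_iff_norm_sub_tendsto_zero.1 h1
  rw [integral_zero] at hdct
  refine tendsto_iff_norm_sub_tendsto_zero.2 (hdct.congr' ?_)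
  filter_upwards [hev] with h hh
  rw [L1.norm_eq_integral]
  refine integral_congr_ae ?_
  filter_upwards [Lp.coeFn_sub (h⁻¹ • (convectionSemigroup C h (gaussL1 a z) - gaussL1 a z))
      (hflux.toL1 _),
    Lp.coeFn_smul h⁻¹ (convectionSemigroup C h (gaussL1 a z) - gaussL1 a z),
    Lp.coeFn_sub (convectionSemigroup C h (gaussL1 a z)) (gaussL1 a z),
    coeFn_convectionSemigroup_gaussL1 hC hh.1.le ha z, coeFn_gaussL1 ha z, hflux.coeFn_toL1]
    with x h1 h2 h3 h4 h5 h6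
  rw [h1, Pi.sub_apply, h2, Pi.smul_apply, h3, Pi.sub_apply, h4, h5, h6, smul_eq_mul]

/-! ### Positivity -/

theorem coeFn_negPart (u : L1) : (u⁻ : L1) =ᵐ[volume] fun x => max (-u x) 0 := by
  rw [negPart_def]
  filter_upwards [Lp.coeFn_sup (-u) 0, Lp.coeFn_neg u, Lp.coeFn_zero ℝ 1 (volume : Measure Plane)]
    with x h1 h2 h3
  rw [h1, Pi.sup_apply, h2, h3]
  rfl

theorem norm_le_norm_of_nonneg_of_le {u v : L1} (hu : 0 ≤ u) (h : u ≤ v) : ‖u‖ ≤ ‖v‖ :=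
  norm_le_norm_of_abs_le_abs (by rwa [abs_of_nonneg hu, abs_of_nonneg (hu.trans h)])

/-- The norm of the negative part is sublinear; it vanishes exactly on the positive cone. -/
theorem isDominatedSublinear_norm_negPart : IsDominatedSublinear fun u : L1 => ‖u⁻‖ where
  add_le u v := by
    refine (norm_le_norm_of_nonneg_of_le (negPart_nonneg _) ?_).trans (norm_add_le u⁻ v⁻)
    rw [negPart_def (u + v), neg_add]
    exact sup_le (add_le_add (neg_le_negPart u) (neg_le_negPart v))
      (add_nonneg (negPart_nonneg u) (negPart_nonneg v))
  smul_eq c u hc := by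
    have : (c • u)⁻ = c • u⁻ := by
      refine Lp.ext ?_
      filter_upwards [coeFn_negPart (c • u), coeFn_negPart u, Lp.coeFn_smul c u,
        Lp.coeFn_smul c u⁻] with x h1 h2 h3 h4
      rw [h1, h3, h4, Pi.smul_apply, Pi.smul_apply, h2, smul_eq_mul, smul_eq_mul,
        mul_max_of_nonneg _ _ hc, mul_zero, mul_neg]
    rw [this, norm_smul, Real.norm_of_nonneg hc]
  le_norm u := by
    refine norm_le_norm_of_abs_le_abs ?_
    rw [abs_of_nonneg (negPart_nonneg u), negPart_def]
    exact sup_le (neg_le_abs u) (abs_nonneg u)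

theorem norm_negPart_apply_le {S : L1 →L[ℝ] L1} (hS : ∀ u, 0 ≤ u → 0 ≤ S u) {c : ℝ}
    (hc : ‖S‖ ≤ c) (u : L1) : ‖(S u)⁻‖ ≤ c * ‖u⁻‖ := by
  refine (norm_le_norm_of_nonneg_of_le (negPart_nonneg _) ?_).trans (S.le_of_opNorm_le hc u⁻)
  rw [negPart_def]
  refine sup_le ?_ (hS _ (negPart_nonneg u))
  have h1 : S u = S u⁺ - S u⁻ := by rw [← map_sub, posPart_sub_negPart]
  rw [h1, neg_sub]
  exact sub_le_self _ (hS _ (posPart_nonneg u))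

/-- Smoothing estimates for convection on Gaussians carry over to `heatSemigroup ε t u`, a
superposition of Gaussians with weight `u`. -/
theorem convection_heat_of_gaussL1_bound {C : Plane → Plane} (hC : IsAdmissibleVelocity C) {ε : ℝ}
    (hε : 0 < ε) {c : ℝ} {t : ℝ} (ht : 0 < t)
    (hc : ∀ h, 0 < h → h ≤ 1 → ∀ z, ‖convectionSemigroup C h (gaussL1 (4 * ε ^ 2 * t) z)
      - gaussL1 (4 * ε ^ 2 * t) z‖ ≤ h * c) (u : L1) :
    (∃ f, IsGeneratorValue (convectionSemigroup C) (heatSemigroup ε t u) f) ∧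
    ∀ h, 0 < h → h ≤ 1 →
      ‖convectionSemigroup C h (heatSemigroup ε t u) - heatSemigroup ε t u‖ ≤ h * c * ‖u‖ := by
  have ha : 0 < 4 * ε ^ 2 * t := by positivity
  set a := 4 * ε ^ 2 * t
  have hi := integrable_smul_gaussL1 ha u
  have hform : ∀ h, convectionSemigroup C h (heatSemigroup ε t u) - heatSemigroup ε t u
      = ∫ z, u z • (convectionSemigroup C h (gaussL1 a z) - gaussL1 a z) := by
    intro h
    rw [heatSemigroup_eq_integral hε ht, ← ContinuousLinearMap.integral_comp_comm _ hi,
      ← integral_sub ((convectionSemigroup C h).integrable_comp hi) hi]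
    simp only [map_smul, smul_sub]
  have hui := (L1.integrable_coeFn u).norm
  constructor
  · choose f hf using fun z => exists_isGeneratorValue_gaussL1 hC ha z
    refine ⟨∫ z, u z • f z, ?_⟩
    have hdct : Tendsto (fun h : ℝ => ∫ z, u z • h⁻¹ •
        (convectionSemigroup C h (gaussL1 a z) - gaussL1 a z)) (𝓝[>] 0) (𝓝 (∫ z, u z • f z)) := by
      refine tendsto_integral_filter_of_dominated_convergence (fun z => ‖u z‖ * c)
        (Eventually.of_forall fun h => ?_) ?_ (hui.mul_const c)
        (Eventually.of_forall fun z => (hf z).const_smul _)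
      · refine (L1.integrable_coeFn u).aestronglyMeasurable.smul (Continuous.aestronglyMeasurable ?_)
        have h1 := continuous_gaussL1 ha
        exact Continuous.const_smul
          (((convectionSemigroup C h).continuous.comp h1).sub h1) h⁻¹
      · filter_upwards [Ioo_mem_nhdsGT (zero_lt_one' ℝ)] with h hh
        refine Eventually.of_forall fun z => ?_
        rw [norm_smul, norm_smul, norm_inv, Real.norm_of_nonneg hh.1.le]
        refine mul_le_mul_of_nonneg_left ?_ (norm_nonneg _)
        rw [inv_mul_le_iff₀ hh.1]
        exact hc h hh.1 hh.2.le z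
    refine hdct.congr fun h => ?_
    rw [hform, ← integral_smul]
    simp only [smul_comm h⁻¹]
  · intro h hh hh1
    rw [hform, mul_comm, L1.norm_eq_integral u, ← integral_mul_const]
    refine norm_integral_le_of_norm_le (hui.mul_const _) (Eventually.of_forall fun z => ?_)
    rw [norm_smul]
    exact mul_le_mul_of_nonneg_left (hc h hh hh1 z) (norm_nonneg _)

end ReturnHome
end

theorem theorem3p12 (ε : ℝ) (hε : 0 < ε)
    (C : ReturnHome.Plane → ReturnHome.Plane) (hC : ReturnHome.IsAdmissibleVelocity C) :
    (ReturnHome.diffusionOperator ε).domain ≤ (ReturnHome.convectionOperator C).domain ∧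
    ∃ T : ℝ → ReturnHome.L1 →L[ℝ] ReturnHome.L1,
      ReturnHome.IsC0Semigroup T ∧
      ReturnHome.generator T =
        ReturnHome.diffusionOperator ε + ReturnHome.convectionOperator C ∧
      (∀ (v₀ : ReturnHome.L1) (v : ℝ → ReturnHome.L1),
        ReturnHome.IsMildSolution
            (ReturnHome.diffusionOperator ε + ReturnHome.convectionOperator C) v₀ v ↔
          ∀ t : ℝ, 0 ≤ t → v t = T t v₀) ∧
      ∀ v₀ : ReturnHome.L1, 0 ≤ v₀ → ∀ t : ℝ, 0 ≤ t → 0 ≤ T t v₀ := by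
  open ReturnHome in
  obtain ⟨M, hM⟩ := hC.exists_norm_le
  obtain ⟨D, hD0, hD⟩ := hC.exists_abs_divergence_le
  obtain ⟨K, hK⟩ := hC.exists_lipschitzWith
  have hω : 0 ≤ D + 2 * K := by positivity
  set c : ℝ := Real.exp (D + 2 * K) * (2 * M / ε + 2 * D) with hc
  have hgauss : ∀ t, 0 < t → ∀ h, 0 < h → h ≤ 1 → ∀ z,
      ‖convectionSemigroup C h (gaussL1 (4 * ε ^ 2 * t) z) - gaussL1 (4 * ε ^ 2 * t) z‖
        ≤ h * (c * (1 + t ^ (-(1 / 2) : ℝ))) := by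
    intro t ht h hh hh1 z
    refine (norm_convectionSemigroup_gaussL1_sub_le hC hM hD hK (by positivity) z hh).trans ?_
    have e1 : Real.sqrt (4 * ε ^ 2 * t) = 2 * ε * Real.sqrt t := by
      rw [show 4 * ε ^ 2 * t = (2 * ε) ^ 2 * t by ring, Real.sqrt_mul (by positivity),
        Real.sqrt_sq (by positivity)]
    have e2 : t ^ (-(1 / 2) : ℝ) = (Real.sqrt t)⁻¹ := by
      rw [Real.rpow_neg ht.le, Real.sqrt_eq_rpow]
    have e3 : 4 * M / (2 * ε * Real.sqrt t) = 2 * M / ε * (Real.sqrt t)⁻¹ := by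
      have : Real.sqrt t ≠ 0 := (Real.sqrt_pos.2 ht).ne'
      field_simp; ring
    rw [e1, e2, e3, hc, mul_assoc (Real.exp _)]
    have hs : 0 < (Real.sqrt t)⁻¹ := inv_pos.2 (Real.sqrt_pos.2 ht)
    have h1 : (D + 2 * K) * h ≤ D + 2 * K := mul_le_of_le_one_right hω hh1
    have h2 : 2 * M / ε * (Real.sqrt t)⁻¹ + 2 * D
        ≤ (2 * M / ε + 2 * D) * (1 + (Real.sqrt t)⁻¹) := by
      have : 0 ≤ 2 * M / ε := by positivity
      nlinarith
    gcongr
  have hkey := fun t ht => convection_heat_of_gaussL1_bound hC hε ht (hgauss t ht)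
  obtain ⟨hle, T, hT, hTg, hTb, hTp⟩ := exists_semigroup_add (isC0Semigroup_heatSemigroup hε)
    (fun t _ => norm_heatSemigroup_le hε t) hω
    (fun h hh _ => norm_convectionSemigroup_le hC hD hK hh.le)
    (fun t ht u => (hkey t ht u).1) (fun t ht h hh hh1 u => (hkey t ht u).2 h hh hh1)
  refine ⟨hle, T, hT, hTg, fun v₀ v => ?_, fun v₀ hv₀ t ht => ?_⟩
  · rw [diffusionOperator, convectionOperator, ← hTg]
    exact hT.isMildSolution_iff hTb v₀ v
  · have h := hTp _ isDominatedSublinear_norm_negPart (fun h hh _ u => by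
      have h1 := norm_negPart_apply_le (fun u hu => heatSemigroup_nonneg hε hh hu)
        (norm_heatSemigroup_le hε h) (convectionSemigroup C h u)
      rw [one_mul] at h1
      exact h1.trans (norm_negPart_apply_le (fun u hu => convectionSemigroup_nonneg hC hh.le hu)
        (norm_convectionSemigroup_le hC hD hK hh.le) u)) v₀
      (by rw [negPart_eq_zero.2 hv₀, norm_zero]) t ht
    exact negPart_eq_zero.1 (norm_le_zero_iff.1 h)
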